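/- Conventions. Let $k\ge 1$, $d_1,\dots,d_k,l\ge 0$, let $x_i=(x_i[1],\dots,x_i[d_i])$ for $1\le i\le k$ be vectors of integer variables, $t_1,\dots,t_l$ free integer variables, and let $\psi$ be a quantifier-free linear arithmetic formula (a Boolean combination of linear equalities and inequalities with integer coefficients) in all the variables $x_i[j]$ and $t_j$. For $Q\in\{\exists,\forall\}$ and $\phi = Q x_1\cdots Q x_k:\psi$, the model checking problem $\mathsf{FOP}_{\mathbb Z}(\phi)$ is: given finite sets $A_1\subseteq\mathbb Z^{d_1},\dots,A_k\subseteq\mathbb Z^{d_k}$ and integers $\hat t_1,\dots,\hat t_l$, decide whether $Q x_1\in A_1\cdots Q x_k\in A_k:\psi[(t_1,\dots,t_l)\backslash(\hat t_1,\dots,\hat t_l)]$ holds. $\mathsf{FOP}_{\mathbb Z}(Q^k)$ is the class of all these problems. The $k$-SUM problem is: given sets $A_1,\dots,A_k\subseteq\mathbb Z$ of $n$ integers each, decide whether there are $a_1\in A_1,\dots,a_k\in A_k$ with $a_1+\dots+a_k=0$. The input size is $n=\max_i|A_i|$, and all input numbers come from a polynomially sized universe. A problem can be solved in time $T(n)$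 if for every $u\in\mathbb N$ there is a deterministic word RAM program with $O(\log n)$-bit words that correctly decides all instances whose input numbers lie in $\{-n^u,\dots,n^u\}$, and that takes $O(T(n))$ steps, where loading the input costs one step per input word; the program and the implied constants may depend on $u$. Theorem ($k$-SUM is $\mathsf{FOP}_{\mathbb Z}(\exists^k)$-complete). Let $k\ge 3$. (1) $k$-SUM is a problem in $\mathsf{FOP}_{\mathbb Z}(\exists^k)$ (restricted to instances with $|A_1|=\dots=|A_k|$): there is a formula $\exists x_1\cdots\exists x_k:\psi$, with all $d_i=1$ and $l=0$, whose yes-instances are exactly the tuples of finite sets $(A_1,\dots,A_k)$ containing $a_i\in A_i$ with $a_1+\dots+a_k=0$. (2) Let $T:\mathbb N\to\mathbb R$ and assume that $k$-SUM can be solved in time $T(n)$. Then for every problem $P$ in $\mathsf{FOP}_{\mathbb Z}(\exists^k)$ there is a constant $c$ such that $P$ can be solved in time $O(T(n)\log^c n)$. (3) Under the same assumption, for every problem $P$ in $\mathsf{FOP}_{\mathbb Z}(\forall^k)$ there is a constant $c$ such that $P$ can be solved in time $O(T(n)\log^c n)$. -/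

import Mathlib

/-! # Model of computation: a word RAM with unit-cost operations

A machine state consists of registers and of a random access memory whose cells are addressed by
machine words. Programs are built from assignments, arithmetic, bitwise and comparison operations,
indirect loads and stores, branching and loops. Every elementary operation and every test costs one
step. The execution relation carries a bound `B` on the absolute value of machine words: an
operation whose result does not fit into a word has no successor state. -/

namespace WordRAM

/-- Unit-cost binary word operations. -/
inductive BinOp
  | add | sub | mul | div | mod | and | or | xor | shl | shr | lt | eq

/-- Semantics of the word operations. Division rounds down for positive divisors,
bitwise operations act on two's complement, comparisons return `1` or `0`. -/
def BinOp.eval : BinOp → ℤ → ℤ → ℤ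
  | .add, a, b => a + b
  | .sub, a, b => a - b
  | .mul, a, b => a * b
  | .div, a, b => a / b
  | .mod, a, b => a % b
  | .and, a, b => Int.land a b
  | .or, a, b => Int.lor a b
  | .xor, a, b => Int.xor a b
  | .shl, a, b => a * 2 ^ b.toNat
  | .shr, a, b => a / 2 ^ b.toNat
  | .lt, a, b => if a < b then 1 else 0
  | .eq, a, b => if a = b then 1 else 0

/-- Programs. Registers are named by natural numbers; a program mentions only finitely many. -/
inductive Cmd
  /-- no operation -/
  | skip
  /-- `const x v`: put the constant `v` into register `x` -/
  | const (x : ℕ) (v : ℤ)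
  /-- `op o x y z`: put the result of `o` on registers `y` and `z` into register `x` -/
  | op (o : BinOp) (x y z : ℕ)
  /-- `load x y`: put the memory cell whose address is in register `y` into register `x` -/
  | load (x y : ℕ)
  /-- `store x y`: put register `y` into the memory cell whose address is in register `x` -/
  | store (x y : ℕ)
  /-- sequential composition -/
  | seq (p q : Cmd)
  /-- `ite x p q`: run `p` if register `x` is nonzero, and `q` otherwise -/
  | ite (x : ℕ) (p q : Cmd)
  /-- `loop x p`: while register `x` is nonzero, run `p` -/
  | loop (x : ℕ) (p : Cmd)

/-- Machine states: contents of the registers and of the memory. -/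
structure State where
  reg : ℕ → ℤ
  mem : ℤ → ℤ

/-- Write `v` into register `x`. -/
def State.setReg (s : State) (x : ℕ) (v : ℤ) : State :=
  { s with reg := Function.update s.reg x v }

/-- Write `v` into the memory cell with address `a`. -/
def State.setMem (s : State) (a v : ℤ) : State :=
  { s with mem := Function.update s.mem a v }

/-- `Exec B p s t s'`: with words of absolute value at most `B`, the program `p` started in
state `s` halts in state `s'` after exactly `t` steps. -/
inductive Exec (B : ℤ) : Cmd → State → ℕ → State → Prop
  | skip (s : State) : Exec B .skip s 1 s
  | const (s : State) (x : ℕ) (v : ℤ) (h : |v| ≤ B) :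
      Exec B (.const x v) s 1 (s.setReg x v)
  | op (s : State) (o : BinOp) (x y z : ℕ) (h : |o.eval (s.reg y) (s.reg z)| ≤ B) :
      Exec B (.op o x y z) s 1 (s.setReg x (o.eval (s.reg y) (s.reg z)))
  | load (s : State) (x y : ℕ) (h : |s.mem (s.reg y)| ≤ B) :
      Exec B (.load x y) s 1 (s.setReg x (s.mem (s.reg y)))
  | store (s : State) (x y : ℕ) :
      Exec B (.store x y) s 1 (s.setMem (s.reg x) (s.reg y))
  | seq {p q : Cmd} {s s' s'' : State} {t t' : ℕ}
      (hp : Exec B p s t s') (hq : Exec B q s' t' s'') : Exec B (.seq p q) s (t + t') s''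
  | ite_true {x : ℕ} {p q : Cmd} {s s' : State} {t : ℕ}
      (hx : s.reg x ≠ 0) (hp : Exec B p s t s') : Exec B (.ite x p q) s (t + 1) s'
  | ite_false {x : ℕ} {p q : Cmd} {s s' : State} {t : ℕ}
      (hx : s.reg x = 0) (hq : Exec B q s t s') : Exec B (.ite x p q) s (t + 1) s'
  | loop_exit {x : ℕ} {p : Cmd} {s : State}
      (hx : s.reg x = 0) : Exec B (.loop x p) s 1 s
  | loop_step {x : ℕ} {p : Cmd} {s s' s'' : State} {t t' : ℕ}
      (hx : s.reg x ≠ 0) (hp : Exec B p s t s') (hl : Exec B (.loop x p) s' t' s'') :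
      Exec B (.loop x p) s (t + t' + 1) s''

/-- The initial state on a given input: all registers are zero, the input words are in the memory
cells `0, 1, 2, …`, and all other cells are zero. -/
def initState (input : List ℤ) : State where
  reg := fun _ => 0
  mem := fun a => if 0 ≤ a then input.getD a.toNat 0 else 0

end WordRAM

/-! # Decision problems over finite sets of integer vectors -/

namespace FOPZ

/-- An instance: finite sets `A₁ ⊆ ℤ^{d₁}, …, A_k ⊆ ℤ^{d_k}`, each listed without repetition in an
arbitrary order, and integers `t̂₁, …, t̂_l`. -/
structure Instance (k : ℕ) (d : Fin k → ℕ) (l : ℕ) where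
  pts : (i : Fin k) → List (Fin (d i) → ℤ)
  nodup : ∀ i, (pts i).Nodup
  par : Fin l → ℤ

variable {k : ℕ} {d : Fin k → ℕ} {l : ℕ}

/-- The input size `n = max_i |A_i|`. -/
def Instance.size (I : Instance k d l) : ℕ :=
  Finset.univ.sup fun i => (I.pts i).length

/-- All input numbers lie in `{-U, …, U}`. -/
def Instance.BoundedBy (I : Instance k d l) (U : ℕ) : Prop :=
  (∀ i, ∀ x ∈ I.pts i, ∀ j, |x j| ≤ (U : ℤ)) ∧ ∀ j, |I.par j| ≤ (U : ℤ)

/-- The input words: the cardinalities `|A₁|, …, |A_k|`, then `t̂₁, …, t̂_l`, then the coordinates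
of the vectors of `A₁`, vector by vector, then those of `A₂`, and so on. -/
def Instance.code (I : Instance k d l) : List ℤ :=
  List.ofFn (fun i => ((I.pts i).length : ℤ)) ++ List.ofFn I.par ++
    (List.ofFn fun i => (I.pts i).flatMap List.ofFn).flatten

/-- A decision problem: which instances are admissible, and which are yes-instances. -/
structure Problem (k : ℕ) (d : Fin k → ℕ) (l : ℕ) where
  valid : Instance k d l → Prop
  yes : Instance k d l → Prop

/-- `P.SolvableInTime T`: over every polynomially sized universe `{-n^u, …, n^u}`, the problem is
decided by a word RAM program with words of `O(log n)` bits in time `O(T(n))`. The answer `1` or `0`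
is left in register `0`; loading the input into memory is charged one step per input word. -/
def Problem.SolvableInTime (P : Problem k d l) (T : ℕ → ℝ) : Prop :=
  ∀ u : ℕ, ∃ (p : WordRAM.Cmd) (a N : ℕ) (C : ℝ), 0 < C ∧
    ∀ I : Instance k d l, P.valid I → I.BoundedBy (I.size ^ u) →
      ∃ (t : ℕ) (s : WordRAM.State),
        WordRAM.Exec (((I.size + 2) ^ a : ℕ) : ℤ) p (WordRAM.initState I.code) t s ∧
        (P.yes I → s.reg 0 = 1) ∧ (¬ P.yes I → s.reg 0 = 0) ∧
        (N ≤ I.size → ((I.code.length + t : ℕ) : ℝ) ≤ C * T I.size)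

/-- Quantifier-free linear arithmetic formulas over a finite set `V` of integer variables: Boolean
combinations of linear inequalities and equalities with integer coefficients. -/
inductive LinFormula (V : Type)
  /-- `∑ v, c v * v ≤ b` -/
  | le (c : V → ℤ) (b : ℤ)
  /-- `∑ v, c v * v = b` -/
  | eq (c : V → ℤ) (b : ℤ)
  | not (ψ : LinFormula V)
  | and (ψ χ : LinFormula V)
  | or (ψ χ : LinFormula V)

/-- Truth of a formula under an assignment of integers to the variables. -/
def LinFormula.Holds {V : Type} [Fintype V] : LinFormula V → (V → ℤ) → Prop
  | .le c b, val => ∑ v, c v * val v ≤ b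
  | .eq c b, val => ∑ v, c v * val v = b
  | .not ψ, val => ¬ ψ.Holds val
  | .and ψ χ, val => ψ.Holds val ∧ χ.Holds val
  | .or ψ χ, val => ψ.Holds val ∨ χ.Holds val

/-- The variables `x_i[j]` (with `i < k`, `j < d i`) and `t_1, …, t_l`. -/
abbrev Var (k : ℕ) (d : Fin k → ℕ) (l : ℕ) : Type := (Σ i : Fin k, Fin (d i)) ⊕ Fin l

/-- The assignment that gives `x_i` the value `x i` and `t_j` the value `t j`. -/
def assign (x : (i : Fin k) → Fin (d i) → ℤ) (t : Fin l → ℤ) : Var k d l → ℤ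
  | .inl v => x v.1 v.2
  | .inr j => t j

/-- The model checking problem of the sentence `∃ x₁ … ∃ x_k : ψ`. -/
def existsProblem (ψ : LinFormula (Var k d l)) : Problem k d l where
  valid := fun _ => True
  yes := fun I => ∃ x : (i : Fin k) → Fin (d i) → ℤ,
    (∀ i, x i ∈ I.pts i) ∧ ψ.Holds (assign x I.par)

/-- The model checking problem of the sentence `∀ x₁ … ∀ x_k : ψ`. -/
def forallProblem (ψ : LinFormula (Var k d l)) : Problem k d l where
  valid := fun _ => True
  yes := fun I => ∀ x : (i : Fin k) → Fin (d i) → ℤ,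
    (∀ i, x i ∈ I.pts i) → ψ.Holds (assign x I.par)

/-- The `k`-SUM problem: given sets `A₁, …, A_k` of `n` integers each, are there
`a₁ ∈ A₁, …, a_k ∈ A_k` with `a₁ + ⋯ + a_k = 0`? -/
def kSum (k : ℕ) : Problem k (fun _ => 1) 0 where
  valid := fun I => ∀ i, (I.pts i).length = I.size
  yes := fun I => ∃ x : Fin k → Fin 1 → ℤ, (∀ i, x i ∈ I.pts i) ∧ ∑ i, x i 0 = 0

end FOPZ

/-! With negations pushed inwards, `ψ` or its negation becomes a disjunction of clauses, each a
conjunction of strict inequalities `0 < L`. Every affine `L` splits into `k` summands, the `i`-th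
depending on `x_i` only, with parameters and constant term given to the first. A universal sentence
is decided through its negation, so the question is always whether some tuple satisfies all
conditions of some clause.

The key is `sum_pos_iff_exists_sum_ediv`: if all `v_i < 2^e`, then `∑ v_i > 0` holds exactly if `∑
⌊v_i / 2^m⌋ = r` for some scale `m < e` and some `1 ≤ r ≤ k`. Floors only lose, so such an equation
forces positivity. Conversely, refining the scale by one bit at most doubles the sum and adds `k`,
so the sum lies in `{1, …, k}` where it turns positive. A strict inequality thus becomes one of `k *
e = O(log n)` equations. For a clause of at most `M` conditions, one pair `(m, r)` is guessed per
condition, and the resulting equations are packed as digits in a large radix into a single equation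
(`exists_sum_comb_eq_zero_iff`), which is a question for `k`-SUM. There are `O(log^M n)` guesses,
whence the polylogarithmic factor.

A `k`-SUM instance needs exactly `n` distinct numbers per set. Repeated or missing numbers are
replaced by distinct large positive fillers, which cannot take part in a zero sum
(`exists_sum_padded_eq_zero_iff`).

The remaining work is to carry this out on the machine. The given `k`-SUM program runs as a
subroutine in a translated window of memory (`Exec.reloc`, `Tr.call`). Every attempt gets a block of
memory that is still zero, so nothing has to be cleaned up. Preparing an attempt costs `O(n)`, which
is `O(T(n))` because loading a `k`-SUM input is already charged (`natCast_le_of_solves`). -/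

namespace WordRAM

/-! ### Running a program as a subroutine in a window of memory -/

/-- All registers named in the program are below `m`. -/
def Cmd.RegsBelow (m : ℕ) : Cmd → Prop
  | .skip => True
  | .const x _ => x < m
  | .op _ x y z => x < m ∧ y < m ∧ z < m
  | .load x y => x < m ∧ y < m
  | .store x y => x < m ∧ y < m
  | .seq p q => p.RegsBelow m ∧ q.RegsBelow m
  | .ite x p q => x < m ∧ p.RegsBelow m ∧ q.RegsBelow m
  | .loop x p => x < m ∧ p.RegsBelow m

theorem Cmd.RegsBelow.mono {m m' : ℕ} (h : m ≤ m') {p : Cmd} :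
    p.RegsBelow m → p.RegsBelow m' := by
  induction p with
  | skip => exact fun _ => trivial
  | const x v => exact fun hx => lt_of_lt_of_le hx h
  | op o x y z => exact fun ⟨h1, h2, h3⟩ => ⟨h1.trans_le h, h2.trans_le h, h3.trans_le h⟩
  | load x y => exact fun ⟨h1, h2⟩ => ⟨h1.trans_le h, h2.trans_le h⟩
  | store x y => exact fun ⟨h1, h2⟩ => ⟨h1.trans_le h, h2.trans_le h⟩
  | seq p q ihp ihq => exact fun ⟨h1, h2⟩ => ⟨ihp h1, ihq h2⟩
  | ite x p q ihp ihq => exact fun ⟨h1, h2, h3⟩ => ⟨h1.trans_le h, ihp h2, ihq h3⟩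
  | loop x p ihp => exact fun ⟨h1, h2⟩ => ⟨h1.trans_le h, ihp h2⟩

theorem Cmd.exists_regsBelow (p : Cmd) : ∃ m, p.RegsBelow m := by
  induction p with
  | skip => exact ⟨0, trivial⟩
  | const x v => exact ⟨x + 1, Nat.lt_succ_self x⟩
  | op o x y z => exact ⟨x + y + z + 1, by omega, by omega, by omega⟩
  | load x y => exact ⟨x + y + 1, by omega, by omega⟩
  | store x y => exact ⟨x + y + 1, by omega, by omega⟩
  | seq p q ihp ihq =>
    obtain ⟨a, ha⟩ := ihp
    obtain ⟨b, hb⟩ := ihq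
    exact ⟨a + b, ha.mono (by omega), hb.mono (by omega)⟩
  | ite x p q ihp ihq =>
    obtain ⟨a, ha⟩ := ihp
    obtain ⟨b, hb⟩ := ihq
    exact ⟨x + 1 + a + b, by omega, ha.mono (by omega), hb.mono (by omega)⟩
  | loop x p ihp =>
    obtain ⟨a, ha⟩ := ihp
    exact ⟨x + 1 + a, by omega, ha.mono (by omega)⟩

/-- The program `p` with register `r` moved to `f + 2 + r` and with memory addresses shifted by the
contents of register `f`; register `f + 1` is used for the shifted addresses. -/
def Cmd.reloc (f : ℕ) : Cmd → Cmd
  | .skip => .skip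
  | .const x v => .const (f + 2 + x) v
  | .op o x y z => .op o (f + 2 + x) (f + 2 + y) (f + 2 + z)
  | .load x y => .seq (.op .add (f + 1) f (f + 2 + y)) (.load (f + 2 + x) (f + 1))
  | .store x y => .seq (.op .add (f + 1) f (f + 2 + x)) (.store (f + 1) (f + 2 + y))
  | .seq p q => .seq (p.reloc f) (q.reloc f)
  | .ite x p q => .ite (f + 2 + x) (p.reloc f) (q.reloc f)
  | .loop x p => .loop (f + 2 + x) (p.reloc f)

/-- The state `σ` holds the registers below `m` and the memory of `s` at the places used by
`Cmd.reloc`, with shift `β`. -/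
structure Embeds (f m : ℕ) (b β : ℤ) (s σ : State) : Prop where
  small : ∀ r, |s.reg r| ≤ b
  reg : ∀ r < m, σ.reg (f + 2 + r) = s.reg r
  shift : σ.reg f = β
  mem : ∀ a, |a| ≤ b → σ.mem (β + a) = s.mem a

/-- What a relocated program leaves untouched. -/
structure Untouched (f : ℕ) (b β : ℤ) (σ σ' : State) : Prop where
  reg : ∀ r < f, σ'.reg r = σ.reg r
  outside : ∀ a, b < |a - β| → σ'.mem a = σ.mem a
  small : ∀ a, σ'.mem a = σ.mem a ∨ |σ'.mem a| ≤ b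

theorem Untouched.refl (f : ℕ) (b β : ℤ) (σ : State) : Untouched f b β σ σ :=
  ⟨fun _ _ => rfl, fun _ _ => rfl, fun _ => Or.inl rfl⟩

theorem Untouched.trans {f : ℕ} {b β : ℤ} {σ σ' σ'' : State} (h : Untouched f b β σ σ')
    (h' : Untouched f b β σ' σ'') : Untouched f b β σ σ'' where
  reg r hr := (h'.reg r hr).trans (h.reg r hr)
  outside a ha := (h'.outside a ha).trans (h.outside a ha)
  small a := by
    rcases h'.small a with h1 | h1
    · rw [h1]; exact h.small a
    · exact Or.inr h1

theorem Embeds.setReg {f m : ℕ} {b β : ℤ} {s σ : State} (h : Embeds f m b β s σ) (x : ℕ) {v : ℤ}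
    (hv : |v| ≤ b) : Embeds f m b β (s.setReg x v) (σ.setReg (f + 2 + x) v) where
  small r := by
    by_cases hr : r = x
    · subst hr; simpa [State.setReg] using hv
    · simpa [State.setReg, hr] using h.small r
  reg r hr := by
    by_cases hx : r = x
    · subst hx; simp [State.setReg]
    · simpa [State.setReg, hx] using h.reg r hr
  shift := by
    have : f ≠ f + 2 + x := by omega
    simpa [State.setReg, this] using h.shift
  mem := h.mem

theorem Embeds.setAddr {f m : ℕ} {b β : ℤ} {s σ : State} (h : Embeds f m b β s σ) (v : ℤ) :
    Embeds f m b β s (σ.setReg (f + 1) v) where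
  small := h.small
  reg r hr := by
    have : f + 2 + r ≠ f + 1 := by omega
    simpa [State.setReg, this] using h.reg r hr
  shift := by simpa [State.setReg] using h.shift
  mem := h.mem

theorem Untouched.setReg (f : ℕ) (b β : ℤ) (σ : State) {x : ℕ} (hx : f ≤ x) (v : ℤ) :
    Untouched f b β σ (σ.setReg x v) where
  reg r hr := by
    have : r ≠ x := by omega
    simp [State.setReg, this]
  outside _ _ := rfl
  small _ := Or.inl rfl

/-- Induction on the execution. Only loads and stores get longer, from one step to two, by the
addition that computes the shifted address; hence the factor 2. Addresses come from registers, and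
all registers of the original run stay within `b`, so memory is touched only within distance `b` of
`β`. -/
theorem Exec.reloc {f m : ℕ} {b B β : ℤ} (hB : b ≤ B) (hβ : ∀ a, |a| ≤ b → |β + a| ≤ B)
    {p : Cmd} {s s' : State} {t : ℕ} (h : Exec b p s t s') :
    p.RegsBelow m → ∀ σ, Embeds f m b β s σ →
      ∃ t' σ', Exec B (p.reloc f) σ t' σ' ∧ t' ≤ 2 * t ∧ Embeds f m b β s' σ' ∧
        Untouched f b β σ σ' := by
  induction h with
  | skip s => exact fun _ σ hσ => ⟨1, σ, .skip σ, by omega, hσ, .refl ..⟩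
  | const s x v h =>
    exact fun _ σ hσ => ⟨1, _, .const σ _ v (h.trans hB), by omega, hσ.setReg x h,
      .setReg _ _ _ _ (by omega) _⟩
  | op s o x y z h =>
    rintro ⟨-, hy, hz⟩ σ hσ
    rw [← hσ.reg y hy, ← hσ.reg z hz] at h ⊢
    exact ⟨1, _, .op σ o _ _ _ (h.trans hB), by omega, hσ.setReg x h,
      .setReg _ _ _ _ (by omega) _⟩
  | load s x y h =>
    rintro ⟨-, hy⟩ σ hσ
    have ha : σ.reg f + σ.reg (f + 2 + y) = β + s.reg y := by rw [hσ.shift, hσ.reg y hy]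
    have hm := hσ.mem _ (hσ.small y)
    have h1 : Exec B (.op .add (f + 1) f (f + 2 + y)) σ 1 (σ.setReg (f + 1) (β + s.reg y)) := by
      have := Exec.op (B := B) σ .add (f + 1) f (f + 2 + y)
        (by simpa [BinOp.eval, ha] using hβ _ (hσ.small y))
      simpa only [BinOp.eval, ha] using this
    have h2 : Exec B (.load (f + 2 + x) (f + 1)) (σ.setReg (f + 1) (β + s.reg y)) 1
        ((σ.setReg (f + 1) (β + s.reg y)).setReg (f + 2 + x) (s.mem (s.reg y))) := by
      have := Exec.load (B := B) (σ.setReg (f + 1) (β + s.reg y)) (f + 2 + x) (f + 1)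
        (by simpa [State.setReg, hm] using h.trans hB)
      simpa [State.setReg, hm] using this
    exact ⟨2, _, .seq h1 h2, by omega, (hσ.setAddr _).setReg x h,
      (Untouched.setReg _ _ _ _ (by omega) _).trans (.setReg _ _ _ _ (by omega) _)⟩
  | store s x y =>
    rintro ⟨hx, hy⟩ σ hσ
    have ha : σ.reg f + σ.reg (f + 2 + x) = β + s.reg x := by rw [hσ.shift, hσ.reg x hx]
    have h1 : Exec B (.op .add (f + 1) f (f + 2 + x)) σ 1 (σ.setReg (f + 1) (β + s.reg x)) := by
      have := Exec.op (B := B) σ .add (f + 1) f (f + 2 + x)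
        (by simpa [BinOp.eval, ha] using hβ _ (hσ.small x))
      simpa only [BinOp.eval, ha] using this
    have hσ1 := hσ.setAddr (β + s.reg x)
    have h2 : Exec B (.store (f + 1) (f + 2 + y)) (σ.setReg (f + 1) (β + s.reg x)) 1
        ((σ.setReg (f + 1) (β + s.reg x)).setMem (β + s.reg x) (s.reg y)) := by
      have := Exec.store (B := B) (σ.setReg (f + 1) (β + s.reg x)) (f + 1) (f + 2 + y)
      rw [hσ1.reg y hy] at this
      simpa [State.setReg] using this
    refine ⟨2, _, .seq h1 h2, by omega, ⟨hσ.small, hσ1.reg, hσ1.shift, ?_⟩,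
      (Untouched.setReg _ _ _ _ (by omega) _).trans ⟨fun _ _ => rfl, ?_, ?_⟩⟩
    · intro a ha
      by_cases hax : a = s.reg x
      · subst hax; simp [State.setMem]
      · simpa [State.setMem, State.setReg, hax] using hσ.mem a ha
    · intro a ha
      have : a ≠ β + s.reg x := by
        rintro rfl
        have := hσ.small x
        simp only [add_sub_cancel_left] at ha
        omega
      simp [State.setMem, this]
    · intro a
      by_cases hax : a = β + s.reg x
      · right; subst hax; simpa [State.setMem] using hσ.small y
      · left; simp [State.setMem, hax]
  | seq _ _ ihp ihq =>
    rintro ⟨hp, hq⟩ σ hσ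
    obtain ⟨t1, σ1, e1, l1, m1, u1⟩ := ihp hp σ hσ
    obtain ⟨t2, σ2, e2, l2, m2, u2⟩ := ihq hq σ1 m1
    exact ⟨_, σ2, .seq e1 e2, by omega, m2, u1.trans u2⟩
  | ite_true hx _ ihp =>
    rintro ⟨hr, hp, -⟩ σ hσ
    obtain ⟨t1, σ1, e1, l1, m1, u1⟩ := ihp hp σ hσ
    exact ⟨_, σ1, .ite_true (by rwa [hσ.reg _ hr]) e1, by omega, m1, u1⟩
  | ite_false hx _ ihp =>
    rintro ⟨hr, -, hp⟩ σ hσ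
    obtain ⟨t1, σ1, e1, l1, m1, u1⟩ := ihp hp σ hσ
    exact ⟨_, σ1, .ite_false (by rwa [hσ.reg _ hr]) e1, by omega, m1, u1⟩
  | loop_exit hx =>
    rintro ⟨hr, -⟩ σ hσ
    exact ⟨_, σ, .loop_exit (by rwa [hσ.reg _ hr]), by omega, hσ, .refl ..⟩
  | loop_step hx _ _ ihp ihl =>
    rintro ⟨hr, hp⟩ σ hσ
    obtain ⟨t1, σ1, e1, l1, m1, u1⟩ := ihp hp σ hσ
    obtain ⟨t2, σ2, e2, l2, m2, u2⟩ := ihl ⟨hr, hp⟩ σ1 m1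
    exact ⟨_, σ2, .loop_step (by rwa [hσ.reg _ hr]) e1 e2, by omega, m2, u1.trans u2⟩

/-- Set the registers `f, …, f + m - 1` to zero. -/
def Cmd.clear (f : ℕ) : ℕ → Cmd
  | 0 => .skip
  | m + 1 => .seq (Cmd.clear f m) (.const (f + m) 0)

/-- The subroutine is called many times and leaves garbage in its registers, whereas its
specification starts from registers that are all zero. -/
theorem exec_clear {B : ℤ} (hB : 0 ≤ B) (f m : ℕ) (σ : State) :
    ∃ σ', Exec B (Cmd.clear f m) σ (m + 1) σ' ∧ (∀ r < m, σ'.reg (f + r) = 0) ∧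
      (∀ r < f, σ'.reg r = σ.reg r) ∧ σ'.mem = σ.mem := by
  induction m with
  | zero => exact ⟨σ, .skip σ, by simp, fun _ _ => rfl, rfl⟩
  | succ m ih =>
    obtain ⟨σ', e, h1, h2, h3⟩ := ih
    refine ⟨_, .seq e (.const σ' (f + m) 0 (by simpa using hB)), ?_, ?_, h3⟩
    · intro r hr
      by_cases hm : r = m
      · subst hm; simp [State.setReg]
      · simpa [State.setReg, hm] using h1 r (by omega)
    · intro r hr
      have : r ≠ f + m := by omega
      simpa [State.setReg, this] using h2 r hr

end WordRAM

namespace WordRAM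

/-! ### Expressions over named variables -/

/-- The program variables. -/
inductive Slot
  | acc | size | bits | idx | pos | ptr | val
  deriving DecidableEq

/-- The register that holds a program variable. -/
def Slot.num : Slot → ℕ
  | .acc => 0 | .size => 1 | .bits => 2 | .idx => 3 | .pos => 4 | .ptr => 5 | .val => 6

theorem Slot.num_lt (x : Slot) : x.num < 7 := by cases x <;> simp [Slot.num]

theorem Slot.num_injective : Function.Injective Slot.num := by
  intro x y; cases x <;> cases y <;> simp [Slot.num]

/-- The values of the program variables, and the memory. -/
structure Store where
  var : Slot → ℤ
  mem : ℤ → ℤ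

/-- Assign `v` to the variable `x`. -/
def Store.set (s : Store) (x : Slot) (v : ℤ) : Store :=
  { s with var := Function.update s.var x v }

/-- Write `v` into the memory cell with address `a`. -/
def Store.put (s : Store) (a v : ℤ) : Store :=
  { s with mem := Function.update s.mem a v }

@[simp] theorem Store.set_mem (s : Store) (x : Slot) (v : ℤ) : (s.set x v).mem = s.mem := rfl
@[simp] theorem Store.put_var (s : Store) (a v : ℤ) : (s.put a v).var = s.var := rfl

@[simp] theorem Store.set_var (s : Store) (x y : Slot) (v : ℤ) :
    (s.set x v).var y = if y = x then v else s.var y := by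
  simp [Store.set, Function.update_apply]

@[simp] theorem Store.put_mem (s : Store) (a b v : ℤ) :
    (s.put a v).mem b = if b = a then v else s.mem b := by
  simp [Store.put, Function.update_apply]

/-- The machine state `σ` represents `s`. -/
structure Repr (σ : State) (s : Store) : Prop where
  var : ∀ x : Slot, σ.reg x.num = s.var x
  mem : σ.mem = s.mem

/-- The word operations with polynomially bounded results. -/
inductive TameOp
  | add | sub | mul | div | mod | shr | lt | eq

def TameOp.toBin : TameOp → BinOp
  | .add => .add | .sub => .sub | .mul => .mul | .div => .div | .mod => .mod
  | .shr => .shr | .lt => .lt | .eq => .eq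

/-- The product of the two bounds, doubled, dominates every case, and the extra factor `N ≥ 2` pays
for the doubling. Left shifts are not among these operations, since their results are not
polynomially bounded. -/
theorem TameOp.abs_eval_le (o : TameOp) (a b : ℤ) {N : ℤ} (hN : 2 ≤ N) {x y : ℕ}
    (ha : |a| ≤ N ^ x) (hb : |b| ≤ N ^ y) : |o.toBin.eval a b| ≤ N ^ (x + y + 1) := by
  have h1 : (1 : ℤ) ≤ N ^ x := one_le_pow₀ (by omega)
  have h2 : (1 : ℤ) ≤ N ^ y := one_le_pow₀ (by omega)
  have hxy : N ^ (x + y + 1) = N ^ x * N ^ y * N := by ring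
  have h3 : N ^ x * N ^ y * 2 ≤ N ^ (x + y + 1) := by rw [hxy]; gcongr
  have h4 : N ^ x + N ^ y ≤ N ^ x * N ^ y * 2 := by nlinarith
  have h5 : N ^ x * N ^ y ≤ N ^ x * N ^ y * 2 := by nlinarith
  cases o with
  | add => exact (abs_add_le a b).trans (by linarith)
  | sub => exact (abs_sub a b).trans (by linarith)
  | mul =>
    have : |a * b| ≤ N ^ x * N ^ y := by rw [abs_mul]; gcongr
    exact this.trans (by linarith)
  | div => exact (Int.abs_ediv_le_abs a b).trans (by linarith)
  | mod =>
    change |a % b| ≤ _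
    by_cases hb0 : b = 0
    · subst hb0; rw [Int.emod_zero]; linarith
    · rw [abs_of_nonneg (Int.emod_nonneg a hb0)]
      linarith [Int.emod_lt_abs a hb0]
  | shr => exact (Int.abs_ediv_le_abs a _).trans (by linarith)
  | lt => change |if a < b then (1 : ℤ) else 0| ≤ _; split_ifs <;> simp <;> nlinarith
  | eq => change |if a = b then (1 : ℤ) else 0| ≤ _; split_ifs <;> simp <;> nlinarith

/-- Integer expressions. -/
inductive Expr
  | num (v : ℤ)
  | var (x : Slot)
  | bin (o : TameOp) (a b : Expr)
  | ld (a : Expr)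

namespace Expr

instance : Add Expr := ⟨bin .add⟩
instance : Sub Expr := ⟨bin .sub⟩
instance : Mul Expr := ⟨bin .mul⟩
instance : Div Expr := ⟨bin .div⟩
instance : Mod Expr := ⟨bin .mod⟩

/-- `1` if `a < b`, and `0` otherwise -/
def lt (a b : Expr) : Expr := bin .lt a b
/-- `1` if `a = b`, and `0` otherwise -/
def eq (a b : Expr) : Expr := bin .eq a b
/-- `a` shifted to the right by `b` bits -/
def shr (a b : Expr) : Expr := bin .shr a b

def eval (s : Store) : Expr → ℤ
  | num v => v
  | var x => s.var x
  | bin o a b => o.toBin.eval (a.eval s) (b.eval s)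
  | ld a => s.mem (a.eval s)

section
variable (s : Store) (a b : Expr)

@[simp] theorem eval_num (v : ℤ) : (num v).eval s = v := rfl
@[simp] theorem eval_var (x : Slot) : (var x).eval s = s.var x := rfl
@[simp] theorem eval_ld : (ld a).eval s = s.mem (a.eval s) := rfl
@[simp] theorem eval_add : (a + b).eval s = a.eval s + b.eval s := rfl
@[simp] theorem eval_sub : (a - b).eval s = a.eval s - b.eval s := rfl
@[simp] theorem eval_mul : (a * b).eval s = a.eval s * b.eval s := rfl
@[simp] theorem eval_div : (a / b).eval s = a.eval s / b.eval s := rfl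
@[simp] theorem eval_mod : (a % b).eval s = a.eval s % b.eval s := rfl
@[simp] theorem eval_lt : (lt a b).eval s = if a.eval s < b.eval s then 1 else 0 := rfl
@[simp] theorem eval_eq : (eq a b).eval s = if a.eval s = b.eval s then 1 else 0 := rfl
@[simp] theorem eval_shr : (shr a b).eval s = a.eval s / 2 ^ (b.eval s).toNat := rfl

end

/-- The sum of a list of expressions. -/
def sum : List Expr → Expr
  | [] => num 0
  | e :: es => e + sum es

theorem eval_sum (s : Store) (es : List Expr) : (sum es).eval s = (es.map (eval s)).sum := by
  induction es with
  | nil => rfl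
  | cons e es ih => simp [sum, ih]

@[simp] theorem eval_sum_ofFn (s : Store) {n : ℕ} (f : Fin n → Expr) :
    (sum (List.ofFn f)).eval s = ∑ i, (f i).eval s := by
  rw [eval_sum, List.map_ofFn, List.sum_ofFn]; rfl

/-- Powers of an expression. -/
def pow (e : Expr) : ℕ → Expr
  | 0 => num 1
  | n + 1 => pow e n * e

@[simp] theorem eval_pow (s : Store) (e : Expr) (n : ℕ) :
    (pow e n).eval s = e.eval s ^ n := by
  induction n with
  | zero => simp [pow]
  | succ n ih => simp [pow, ih, pow_succ]

/-- Evaluate an expression into register `r`, using the registers from `r` on. -/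
def compile : Expr → ℕ → Cmd
  | num v, r => .const r v
  | var x, r => .seq (.const r 0) (.op .add r x.num r)
  | bin o a b, r => .seq (a.compile r) (.seq (b.compile (r + 1)) (.op o.toBin r r (r + 1)))
  | ld a, r => .seq (a.compile r) (.load r r)

/-- Number of steps of the compiled expression. -/
def cost : Expr → ℕ
  | num _ => 1
  | var _ => 2
  | bin _ a b => a.cost + (b.cost + 1)
  | ld a => a.cost + 1

/-- If all variables and memory cells are at most `N ^ E`, then all intermediate results are at
most `N ^ e.need E`. -/
def need (E : ℕ) : Expr → ℕ
  | num v => v.natAbs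
  | var _ => E
  | bin _ a b => a.need E + b.need E + 1
  | ld a => a.need E + E

end Expr

/-- All variables and memory cells are at most `N ^ E`. -/
structure Store.Bounded (N : ℤ) (E : ℕ) (s : Store) : Prop where
  var : ∀ x, |s.var x| ≤ N ^ E
  mem : ∀ a, |s.mem a| ≤ N ^ E

theorem Store.Bounded.set {N : ℤ} {E : ℕ} {s : Store} (h : s.Bounded N E) (x : Slot) {v : ℤ}
    (hv : |v| ≤ N ^ E) : (s.set x v).Bounded N E where
  var y := by rw [Store.set_var]; split_ifs; exacts [hv, h.var y]
  mem := h.mem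

theorem Store.Bounded.put {N : ℤ} {E : ℕ} {s : Store} (h : s.Bounded N E) (a : ℤ) {v : ℤ}
    (hv : |v| ≤ N ^ E) : (s.put a v).Bounded N E where
  var := h.var
  mem b := by rw [Store.put_mem]; split_ifs; exacts [hv, h.mem b]

theorem Expr.abs_eval_le {N : ℤ} (hN : 2 ≤ N) {E : ℕ} {s : Store} (hs : s.Bounded N E)
    (e : Expr) : |e.eval s| ≤ N ^ e.need E := by
  induction e with
  | num v =>
    -- Word bounds are pure powers of `N`, so a constant has to be paid for by an exponent: `|v| < 2
    -- ^ |v| ≤ N ^ |v|`.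
    have h1 : ((v.natAbs : ℕ) : ℤ) < 2 ^ v.natAbs := by exact_mod_cast Nat.lt_two_pow_self
    have h2 : (2 : ℤ) ^ v.natAbs ≤ N ^ v.natAbs := by gcongr
    rw [Expr.eval_num, Expr.need, Int.abs_eq_natAbs]
    exact (h1.trans_le h2).le
  | var x => exact hs.var x
  | bin o a b iha ihb => exact o.abs_eval_le _ _ hN iha ihb
  | ld a ih =>
    exact (hs.mem _).trans (pow_le_pow_right₀ (by omega) (Nat.le_add_left _ _))

/-- Registers are used like a stack: variables live below 7, and evaluation into `r` preserves
everything below `r`, so a left operand survives the evaluation of the right one. -/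
theorem Expr.exec_compile {N : ℤ} (hN : 2 ≤ N) {E : ℕ} {s : Store} (hs : s.Bounded N E) {a : ℕ}
    (e : Expr) : e.need E ≤ a → ∀ (r : ℕ) (σ : State), 7 ≤ r → Repr σ s →
    ∃ σ', Exec (N ^ a) (e.compile r) σ e.cost σ' ∧ σ'.reg r = e.eval s ∧
      (∀ q < r, σ'.reg q = σ.reg q) ∧ σ'.mem = σ.mem := by
  have hup : ∀ {v : ℤ} {m : ℕ}, m ≤ a → |v| ≤ N ^ m → |v| ≤ N ^ a := fun h1 h2 =>
    h2.trans (pow_le_pow_right₀ (by omega) h1)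
  have hset : ∀ (σ : State) (r : ℕ) (v : ℤ), ∀ q < r, (σ.setReg r v).reg q = σ.reg q := by
    intro σ r v q hq
    simp [State.setReg, hq.ne]
  have hrepr : ∀ {σ σ' : State} {r : ℕ}, 7 ≤ r → Repr σ s → (∀ q < r, σ'.reg q = σ.reg q) →
      σ'.mem = σ.mem → Repr σ' s := fun hr h h1 h2 =>
    ⟨fun x => (h1 _ (x.num_lt.trans_le hr)).trans (h.var x), h2.trans h.mem⟩
  induction e with
  | num v =>
    intro ha r σ _ _
    exact ⟨_, .const σ r v (hup ha (Expr.abs_eval_le hN hs (.num v))), by simp [State.setReg],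
      hset σ r v, rfl⟩
  | var x =>
    intro ha r σ hr hσ
    have hx : x.num ≠ r := (x.num_lt.trans_le hr).ne
    -- The machine has no move instruction; a register is copied by adding zero.
    have h0 : Exec (N ^ a) (.const r 0) σ 1 (σ.setReg r 0) :=
      .const σ r 0 (by rw [abs_zero]; positivity)
    have he : BinOp.add.eval ((σ.setReg r 0).reg x.num) ((σ.setReg r 0).reg r) = s.var x := by
      simp [State.setReg, BinOp.eval, hx, hσ.var]
    refine ⟨_, .seq h0 (.op _ .add r x.num r (by rw [he]; exact hup ha (hs.var x))),
      by rw [he]; simp [State.setReg], fun q hq => ?_, rfl⟩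
    rw [hset _ _ _ q hq, hset _ _ _ q hq]
  | bin o b c ihb ihc =>
    intro ha r σ hr hσ
    obtain ⟨σ1, e1, v1, r1, m1⟩ := ihb (by rw [Expr.need] at ha; omega) r σ hr hσ
    obtain ⟨σ2, e2, v2, r2, m2⟩ := ihc (by rw [Expr.need] at ha; omega) (r + 1) σ1 (by omega)
      (hrepr hr hσ r1 m1)
    have he : o.toBin.eval (σ2.reg r) (σ2.reg (r + 1)) = (Expr.bin o b c).eval s := by
      rw [r2 r (by omega), v1, v2]; rfl
    refine ⟨_, .seq e1 (.seq e2 (.op σ2 o.toBin r r (r + 1) ?_)), ?_, fun q hq => ?_,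
      m2.trans m1⟩
    · rw [he]; exact hup ha (Expr.abs_eval_le hN hs _)
    · rw [he]; simp [State.setReg]
    · rw [hset _ _ _ q hq, r2 q (by omega), r1 q hq]
  | ld b ih =>
    intro ha r σ hr hσ
    obtain ⟨σ1, e1, v1, r1, m1⟩ := ih (by rw [Expr.need] at ha; omega) r σ hr hσ
    have he : σ1.mem (σ1.reg r) = (Expr.ld b).eval s := by rw [m1, hσ.mem, v1]; rfl
    refine ⟨_, .seq e1 (.load σ1 r r ?_), ?_, fun q hq => ?_, m1⟩
    · rw [he]; exact hup ha (Expr.abs_eval_le hN hs _)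
    · rw [he]; simp [State.setReg]
    · rw [hset _ _ _ q hq, r1 q hq]

/-! ### Structured programs -/

/-- A program together with the exponent of the word bound that it needs when variables and memory
cells are at most `N ^ E`. -/
structure Prog where
  cmd : Cmd
  need : ℕ → ℕ

namespace Prog

def skip : Prog := ⟨.skip, fun _ => 0⟩

/-- `x := e` -/
def assign (x : Slot) (e : Expr) : Prog :=
  ⟨.seq (e.compile 7) (.seq (.const 8 0) (.op .add x.num 7 8)), fun E => e.need E⟩

/-- `mem[e] := e'` -/
def store (e e' : Expr) : Prog :=
  ⟨.seq (e.compile 7) (.seq (e'.compile 8) (.store 7 8)), fun E => e.need E + e'.need E⟩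

def seq (P Q : Prog) : Prog := ⟨.seq P.cmd Q.cmd, fun E => P.need E + Q.need E⟩

def ite (e : Expr) (P Q : Prog) : Prog :=
  ⟨.seq (e.compile 7) (.ite 7 P.cmd Q.cmd), fun E => e.need E + P.need E + Q.need E⟩

def loop (e : Expr) (P : Prog) : Prog :=
  ⟨.seq (e.compile 7) (.loop 7 (.seq P.cmd (e.compile 7))), fun E => e.need E + P.need E⟩

/-- Run `P` for `x = 0, …, e - 1`. -/
def range (x : Slot) (e : Expr) (P : Prog) : Prog :=
  (assign x (.num 0)).seq (.loop (.lt (.var x) e) (P.seq (assign x (.var x + .num 1))))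

/-- Run `p` with memory addresses shifted by `e`, from cleared registers below `m`, and assign the
contents of its register `0` to `x`. -/
def call (p : Cmd) (m b : ℕ) (e : Expr) (x : Slot) : Prog :=
  ⟨.seq (e.compile 7) (.seq (Cmd.clear 8 (m + 1)) (.seq (p.reloc 7)
    (.seq (.const 8 0) (.op .add x.num 9 8)))),
    fun E => e.need E + b + E + e.need E + 1⟩

end Prog

/-- If the variables and memory cells of `s` are at most `N ^ E`, then `P` started in `s` halts
with variables and memory cells at most `N ^ E` in a situation described by `Q`, after at most `t`
steps provided that `G` holds. -/
def Tr (G : Prop) (N : ℤ) (E : ℕ) (P : Prog) (s : Store) (t : ℕ) (Q : Store → Prop) : Prop :=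
  s.Bounded N E → ∀ a, P.need E ≤ a → ∀ σ, Repr σ s →
    ∃ t' σ' s', Exec (N ^ a) P.cmd σ t' σ' ∧ (G → t' ≤ t) ∧ Repr σ' s' ∧ s'.Bounded N E ∧ Q s'

namespace Tr

variable {G : Prop} {N : ℤ} {E : ℕ} {P P' : Prog} {s : Store} {t t' : ℕ} {Q Q' : Store → Prop}

theorem mono (h : Tr G N E P s t Q) (ht : t ≤ t') (hQ : ∀ s', s'.Bounded N E → Q s' → Q' s') :
    Tr G N E P s t' Q' := by
  intro hs a ha σ hσ
  obtain ⟨t1, σ1, s1, e1, l1, m1, b1, q1⟩ := h hs a ha σ hσ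
  exact ⟨t1, σ1, s1, e1, fun g => (l1 g).trans ht, m1, b1, hQ s1 b1 q1⟩

theorem skip (h : Q s) : Tr G N E .skip s 1 Q :=
  fun hs _ _ σ hσ => ⟨1, σ, s, .skip σ, fun _ => le_rfl, hσ, hs, h⟩

theorem seq (h : Tr G N E P s t fun s' => Tr G N E P' s' t' Q) :
    Tr G N E (P.seq P') s (t + t') Q := by
  intro hs a ha σ hσ
  obtain ⟨t1, σ1, s1, e1, l1, m1, b1, q1⟩ := h hs a (by simp only [Prog.seq] at ha; omega) σ hσ
  obtain ⟨t2, σ2, s2, e2, l2, m2, b2, q2⟩ := q1 b1 a (by simp only [Prog.seq] at ha; omega) σ1 m1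
  exact ⟨_, σ2, s2, .seq e1 e2, fun g => Nat.add_le_add (l1 g) (l2 g), m2, b2, q2⟩

variable (hN : 2 ≤ N)
include hN

theorem assign {x : Slot} {e : Expr} (he : |e.eval s| ≤ N ^ E) (h : Q (s.set x (e.eval s))) :
    Tr G N E (.assign x e) s (e.cost + 2) Q := by
  intro hs a ha σ hσ
  obtain ⟨σ1, e1, v1, r1, m1⟩ := e.exec_compile hN hs ha 7 σ le_rfl hσ
  have h0 : Exec (N ^ a) (.const 8 0) σ1 1 (σ1.setReg 8 0) :=
    .const σ1 8 0 (by rw [abs_zero]; positivity)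
  have hv : BinOp.add.eval ((σ1.setReg 8 0).reg 7) ((σ1.setReg 8 0).reg 8) = e.eval s := by
    simp [State.setReg, BinOp.eval, v1]
  refine ⟨_, _, s.set x (e.eval s),
    .seq e1 (.seq h0 (.op _ .add x.num 7 8 ?_)), fun _ => le_rfl, ?_, hs.set x he, h⟩
  · rw [hv]
    exact (e.abs_eval_le hN hs).trans (pow_le_pow_right₀ (by omega) ha)
  · rw [hv]
    refine ⟨fun y => ?_, m1.trans hσ.mem⟩
    have h8 : y.num ≠ 8 := by have := y.num_lt; omega
    by_cases hy : y = x
    · subst hy; simp [State.setReg]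
    · have : y.num ≠ x.num := fun h => hy (Slot.num_injective h)
      simp [State.setReg, hy, this, h8, r1 _ y.num_lt, hσ.var]

theorem store {e e' : Expr} (he : |e'.eval s| ≤ N ^ E) (h : Q (s.put (e.eval s) (e'.eval s))) :
    Tr G N E (.store e e') s (e.cost + (e'.cost + 1)) Q := by
  intro hs a ha σ hσ
  simp only [Prog.store] at ha
  obtain ⟨σ1, e1, v1, r1, m1⟩ := e.exec_compile hN hs (a := a) (by omega) 7 σ le_rfl hσ
  have hσ1 : Repr σ1 s := ⟨fun y => (r1 _ y.num_lt).trans (hσ.var y), m1.trans hσ.mem⟩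
  obtain ⟨σ2, e2, v2, r2, m2⟩ := e'.exec_compile hN hs (a := a) (by omega) 8 σ1 (by omega) hσ1
  refine ⟨_, _, s.put (e.eval s) (e'.eval s), .seq e1 (.seq e2 (.store σ2 7 8)),
    fun _ => le_rfl, ⟨fun y => ?_, ?_⟩, hs.put _ he, h⟩
  · exact (r2 _ (by have := y.num_lt; omega)).trans (hσ1.var y)
  · rw [r2 7 (by omega), v1, v2]
    simp [State.setMem, Store.put, m2, hσ1.mem]

theorem ite {e : Expr} (h1 : e.eval s ≠ 0 → Tr G N E P s t Q)
    (h2 : e.eval s = 0 → Tr G N E P' s t' Q) :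
    Tr G N E (.ite e P P') s (e.cost + (max t t' + 1)) Q := by
  intro hs a ha σ hσ
  simp only [Prog.ite] at ha
  obtain ⟨σ1, e1, v1, r1, m1⟩ := e.exec_compile hN hs (a := a) (by omega) 7 σ le_rfl hσ
  have hσ1 : Repr σ1 s := ⟨fun y => (r1 _ y.num_lt).trans (hσ.var y), m1.trans hσ.mem⟩
  by_cases h : e.eval s = 0
  · obtain ⟨t2, σ2, s2, e2, l2, m2, b2, q2⟩ := h2 h hs a (by omega) σ1 hσ1
    exact ⟨_, σ2, s2, .seq e1 (.ite_false (by rw [v1, h]) e2),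
      fun g => by have := l2 g; omega, m2, b2, q2⟩
  · obtain ⟨t2, σ2, s2, e2, l2, m2, b2, q2⟩ := h1 h hs a (by omega) σ1 hσ1
    exact ⟨_, σ2, s2, .seq e1 (.ite_true (by rwa [v1]) e2),
      fun g => by have := l2 g; omega, m2, b2, q2⟩

/-- The number `J` of iterations is fixed in advance and the invariant is indexed by the iterations
already done, so induction on the remaining ones gives termination and the time bound together. -/
theorem loop {e : Expr} {J : ℕ} (Inv : ℕ → Store → Prop) (h0 : Inv 0 s)
    (hstep : ∀ j < J, ∀ s, Inv j s → e.eval s ≠ 0 ∧ Tr G N E P s t (Inv (j + 1)))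
    (hend : ∀ s, Inv J s → e.eval s = 0 ∧ Q s) :
    Tr G N E (.loop e P) s (J * (t + e.cost + 1) + e.cost + 1) Q := by
  intro hs a ha σ hσ
  simp only [Prog.loop] at ha
  have key : ∀ i j : ℕ, j + i = J → ∀ s σ, s.Bounded N E → Inv j s → Repr σ s →
      σ.reg 7 = e.eval s → ∃ t' σ' s',
        Exec (N ^ a) (.loop 7 (.seq P.cmd (e.compile 7))) σ t' σ' ∧
        (G → t' ≤ i * (t + e.cost + 1) + 1) ∧ Repr σ' s' ∧ s'.Bounded N E ∧ Q s' := by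
    intro i
    induction i with
    | zero =>
      intro j hj s σ hs hI hσ hv
      obtain rfl : j = J := hj
      obtain ⟨hz, hq⟩ := hend s hI
      exact ⟨1, σ, s, .loop_exit (by rw [hv, hz]), fun _ => by omega, hσ, hs, hq⟩
    | succ i ih =>
      intro j hj s σ hs hI hσ hv
      obtain ⟨hz, hb⟩ := hstep j (by omega) s hI
      obtain ⟨t1, σ1, s1, e1, l1, m1, b1, q1⟩ := hb hs a (by omega) σ hσ
      obtain ⟨σ2, e2, v2, r2, m2⟩ := e.exec_compile hN b1 (a := a) (by omega) 7 σ1 le_rfl m1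
      have hσ2 : Repr σ2 s1 := ⟨fun y => (r2 _ y.num_lt).trans (m1.var y), m2.trans m1.mem⟩
      obtain ⟨t3, σ3, s3, e3, l3, m3, b3, q3⟩ := ih (j + 1) (by omega) s1 σ2 b1 q1 hσ2 v2
      refine ⟨_, σ3, s3, .loop_step (by rwa [hv]) (.seq e1 e2) e3, fun g => ?_, m3, b3, q3⟩
      have := l1 g
      have := l3 g
      rw [Nat.succ_mul]
      omega
  obtain ⟨σ1, e1, v1, r1, m1⟩ := e.exec_compile hN hs (a := a) (by omega) 7 σ le_rfl hσ
  have hσ1 : Repr σ1 s := ⟨fun y => (r1 _ y.num_lt).trans (hσ.var y), m1.trans hσ.mem⟩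
  obtain ⟨t2, σ2, s2, e2, l2, m2, b2, q2⟩ := key J 0 (by omega) s σ1 hs h0 hσ1 v1
  exact ⟨_, σ2, s2, .seq e1 e2, fun g => by have := l2 g; omega, m2, b2, q2⟩

theorem range {x : Slot} {e : Expr} {J : ℕ} (hJ : (J : ℤ) ≤ N ^ E) (Inv : ℕ → Store → Prop)
    (h0 : Inv 0 (s.set x 0))
    (he : ∀ j s, Inv j s → e.eval s = J)
    (hx : ∀ j s, Inv j s → s.var x = j)
    (hstep : ∀ j < J, ∀ s, Inv j s →
      Tr G N E P s t fun s' => s'.var x = j ∧ Inv (j + 1) (s'.set x ((j : ℤ) + 1)))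
    (hend : ∀ s, Inv J s → Q s) :
    Tr G N E (.range x e P) s (J * (t + e.cost + 10) + e.cost + 10) Q := by
  have h1 : (1 : ℤ) ≤ N ^ E := one_le_pow₀ (by omega)
  refine (Tr.seq (t := 3)
    (t' := J * (t + 6 + (Expr.lt (.var x) e).cost + 1) + (Expr.lt (.var x) e).cost + 1)
    (Q := Q) (Tr.assign hN (by rw [Expr.eval_num, abs_zero]; omega) ?_)).mono ?_ fun _ _ h => h
  · refine Tr.loop hN (J := J) Inv h0 ?_ ?_
    · intro j hj s hI
      refine ⟨by simp [hx j s hI, he j s hI, hj], ?_⟩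
      refine Tr.seq ((hstep j hj s hI).mono le_rfl ?_)
      rintro s' hb ⟨hv, hI'⟩
      have hv' : (Expr.var x + Expr.num 1).eval s' = (j : ℤ) + 1 := by simp [hv]
      refine Tr.assign hN ?_ (by rwa [hv'])
      rw [hv', abs_of_nonneg (by positivity)]
      exact le_trans (by exact_mod_cast hj) hJ
    · intro s hI
      exact ⟨by simp [hx J s hI, he J s hI], hend s hI⟩
  · have : (Expr.lt (.var x) e).cost = e.cost + 3 := by simp [Expr.lt, Expr.cost]; omega
    rw [this]
    have : t + 6 + (e.cost + 3) + 1 = t + e.cost + 10 := by omega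
    rw [this]
    omega

/-- The subroutine cannot tell its window from a fresh machine as long as the window agrees with
`S.mem` at all addresses within its word bound, negative ones included. Afterwards nothing is known
about the contents of the window, only that the rest of memory is intact. -/
theorem call {p : Cmd} {m b : ℕ} {e : Expr} {x : Slot} {S S' : State}
    (hm : p.RegsBelow m) (hm0 : 0 < m) (hp : Exec (N ^ b) p S t S') (hS : ∀ r, S.reg r = 0) (hbE : b ≤ E)
    (hmem : ∀ a, |a| ≤ N ^ b → s.mem (e.eval s + a) = S.mem a) (ht : G → t ≤ t')
    (h : ∀ s' : Store, s'.var = s.var → (∀ a, N ^ b < |a - e.eval s| → s'.mem a = s.mem a) →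
      Q (s'.set x (S'.reg 0))) :
    Tr G N E (.call p m b e x) s (2 * t' + e.cost + m + 4) Q := by
  intro hs a ha σ hσ
  simp only [Prog.call] at ha
  have hN0 : (0 : ℤ) ≤ N ^ a := by positivity
  have hb0 : (0 : ℤ) ≤ N ^ b := by positivity
  have hba : N ^ b ≤ N ^ a := pow_le_pow_right₀ (by omega) (by omega)
  have hbE' : N ^ b ≤ N ^ E := pow_le_pow_right₀ (by omega) hbE
  obtain ⟨σ1, e1, v1, r1, m1⟩ := e.exec_compile hN hs (a := a) (by omega) 7 σ le_rfl hσ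
  obtain ⟨σ2, e2, z2, r2, m2⟩ := exec_clear hN0 8 (m + 1) σ1
  have hemb : Embeds 7 m (N ^ b) (e.eval s) S σ2 := by
    refine ⟨fun r => by rw [hS r, abs_zero]; exact hb0, fun r hr => ?_, ?_, fun a ha => ?_⟩
    · rw [hS r, ← z2 (r + 1) (by omega)]
      congr 1; omega
    · rw [r2 7 (by omega), v1]
    · rw [m2, m1, hσ.mem, hmem a ha]
  have hshift : ∀ c, |c| ≤ N ^ b → |e.eval s + c| ≤ N ^ a := by
    intro c hc
    refine (TameOp.add.abs_eval_le (e.eval s) c hN (e.abs_eval_le hN hs) hc).trans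
      (pow_le_pow_right₀ (by omega) (by omega))
  obtain ⟨t3, σ3, e3, l3, m3, u3⟩ := hp.reloc hba hshift hm σ2 hemb
  have h0 : Exec (N ^ a) (.const 8 0) σ3 1 (σ3.setReg 8 0) :=
    .const σ3 8 0 (by rwa [abs_zero])
  have hv : BinOp.add.eval ((σ3.setReg 8 0).reg 9) ((σ3.setReg 8 0).reg 8) = S'.reg 0 := by
    have := m3.reg 0 hm0
    simpa [State.setReg, BinOp.eval] using this
  have hσ2m : σ2.mem = s.mem := m2.trans (m1.trans hσ.mem)
  refine ⟨_, _, Store.set ⟨s.var, σ3.mem⟩ x (S'.reg 0),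
    .seq e1 (.seq e2 (.seq e3 (.seq h0 (.op _ .add x.num 9 8 ?_)))), fun g => ?_, ?_, ?_,
    h ⟨s.var, σ3.mem⟩ rfl fun c hc => ?_⟩
  · rw [hv]; exact (m3.small 0).trans hba
  · have := ht g; omega
  · rw [hv]
    refine ⟨fun y => ?_, rfl⟩
    have h8 : y.num ≠ 8 := by have := y.num_lt; omega
    by_cases hy : y = x
    · subst hy; simp [State.setReg]
    · have : y.num ≠ x.num := fun h => hy (Slot.num_injective h)
      have hy7 := y.num_lt
      simp [State.setReg, hy, this, h8, u3.reg _ hy7, r2 _ (by omega : y.num < 8), r1 _ hy7,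
        hσ.var]
  · refine Store.Bounded.set (s := ⟨s.var, σ3.mem⟩) ⟨hs.var, fun c => ?_⟩ x ((m3.small 0).trans hbE')
    rcases u3.small c with h1 | h1
    · change |σ3.mem c| ≤ _
      rw [h1, hσ2m]; exact hs.mem c
    · exact h1.trans hbE'
  · change σ3.mem c = _
    rw [u3.outside c hc, hσ2m]

end Tr

end WordRAM

namespace FOPZ

/-! ### Disjunctive normal forms -/

/-- The affine function `∑ v, c v * v + b`, given by `(c, b)`. -/
abbrev Aff (V : Type) : Type := (V → ℤ) × ℤ

def Aff.value {V : Type} [Fintype V] (L : Aff V) (val : V → ℤ) : ℤ := ∑ v, L.1 v * val v + L.2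

/-- A disjunction of conjunctions of conditions `0 < L`, equivalent to `ψ` or to its negation. -/
def LinFormula.dnf {V : Type} : LinFormula V → Bool → List (List (Aff V))
  | .le c b, true => [[(-c, b + 1)]]
  | .le c b, false => [[(c, -b)]]
  | .eq c b, true => [[(-c, b + 1), (c, -b + 1)]]
  | .eq c b, false => [[(-c, b)], [(c, -b)]]
  | .not ψ, σ => ψ.dnf !σ
  | .and ψ χ, true => (ψ.dnf true).flatMap fun x => (χ.dnf true).map (x ++ ·)
  | .and ψ χ, false => ψ.dnf false ++ χ.dnf false
  | .or ψ χ, true => ψ.dnf true ++ χ.dnf true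
  | .or ψ χ, false => (ψ.dnf false).flatMap fun x => (χ.dnf false).map (x ++ ·)

/-- Truth of a disjunction of conjunctions of conditions `0 < L`. -/
def SomeClause {V : Type} [Fintype V] (cls : List (List (Aff V))) (val : V → ℤ) : Prop :=
  ∃ cl ∈ cls, ∀ L ∈ cl, 0 < L.value val

section
variable {V : Type} [Fintype V] (val : V → ℤ)

theorem someClause_append (c₁ c₂ : List (List (Aff V))) :
    SomeClause (c₁ ++ c₂) val ↔ SomeClause c₁ val ∨ SomeClause c₂ val := by
  simp [SomeClause, or_and_right, exists_or]

theorem someClause_product (c₁ c₂ : List (List (Aff V))) :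
    SomeClause (c₁.flatMap fun x => c₂.map (x ++ ·)) val ↔
      SomeClause c₁ val ∧ SomeClause c₂ val := by
  simp only [SomeClause, List.mem_flatMap, List.mem_map]
  constructor
  · rintro ⟨_, ⟨x, hx, y, hy, rfl⟩, h⟩
    exact ⟨⟨x, hx, fun L hL => h L (List.mem_append_left _ hL)⟩,
      y, hy, fun L hL => h L (List.mem_append_right _ hL)⟩
  · rintro ⟨⟨x, hx, h1⟩, y, hy, h2⟩
    exact ⟨_, ⟨x, hx, y, hy, rfl⟩, fun L hL => (List.mem_append.1 hL).elim (h1 L) (h2 L)⟩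

/-- Both polarities are proved together because `not` swaps them. Over the integers `a ≤ b` means `0
< b + 1 - a`, so strict inequalities suffice; an equation gives one clause of two conditions, and
its negation gives two clauses. -/
theorem LinFormula.someClause_dnf (ψ : LinFormula V) :
    (SomeClause (ψ.dnf true) val ↔ ψ.Holds val) ∧
      (SomeClause (ψ.dnf false) val ↔ ¬ ψ.Holds val) := by
  induction ψ with
  | le c b =>
    constructor <;> simp [SomeClause, dnf, Aff.value, LinFormula.Holds, Finset.sum_neg_distrib]
  | eq c b =>
    constructor
    · simp [SomeClause, dnf, Aff.value, LinFormula.Holds, or_imp, forall_and]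
      omega
    · simp [SomeClause, dnf, Aff.value, LinFormula.Holds]
  | not ψ ih => exact ⟨ih.2, ih.1.trans not_not.symm⟩
  | and ψ χ ih1 ih2 =>
    refine ⟨(someClause_product val _ _).trans (and_congr ih1.1 ih2.1), ?_⟩
    refine (someClause_append val _ _).trans ((or_congr ih1.2 ih2.2).trans ?_)
    exact not_and_or.symm
  | or ψ χ ih1 ih2 =>
    refine ⟨(someClause_append val _ _).trans (or_congr ih1.1 ih2.1), ?_⟩
    refine (someClause_product val _ _).trans ((and_congr ih1.2 ih2.2).trans ?_)
    exact not_or.symm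

end

/-! ### Positivity of a sum by equations between prefixes of its summands -/

/-- Each floor at scale `m` is twice the floor at scale `m + 1` plus one bit, and `k` such bits add
up to at most `k`. -/
theorem sum_ediv_two_pow_le {k : ℕ} (v : Fin k → ℤ) (m : ℕ) :
    ∑ i, v i / 2 ^ m ≤ 2 * ∑ i, v i / 2 ^ (m + 1) + (k : ℤ) := by
  have h : ∀ i, v i / 2 ^ m ≤ 2 * (v i / 2 ^ (m + 1)) + 1 := by
    intro i
    rw [pow_succ, ← Int.ediv_ediv_of_nonneg (by positivity)]
    omega
  calc ∑ i, v i / 2 ^ m ≤ ∑ i, (2 * (v i / 2 ^ (m + 1)) + 1) := Finset.sum_le_sum fun i _ => h i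
    _ = _ := by simp [Finset.sum_add_distrib, Finset.mul_sum]

/-- The index `q` encodes the scale `q / k` and the right-hand side `q % k + 1`. For the forward
direction, pick a scale where the sum of floors is positive while it is nonpositive one scale
further up; by `sum_ediv_two_pow_le` it is then at most `k`. For the converse, multiplying the
floors back by `2 ^ m` only underestimates the sum. -/
theorem sum_pos_iff_exists_sum_ediv {k e : ℕ} (hk : 0 < k) (v : Fin k → ℤ)
    (hv : ∀ i, v i < 2 ^ e) :
    0 < ∑ i, v i ↔ ∃ q < k * e, ∑ i, v i / 2 ^ (q / k) = ((q % k + 1 : ℕ) : ℤ) := by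
  constructor
  · intro h0
    have key : ∀ m, ∑ i, v i / 2 ^ m ≤ 0 → ∃ j < m, 0 < ∑ i, v i / 2 ^ j ∧
        ∑ i, v i / 2 ^ j ≤ (k : ℤ) := by
      intro m
      induction m with
      | zero => intro h; simp at h; omega
      | succ m ih =>
        intro h
        by_cases hm : ∑ i, v i / 2 ^ m ≤ 0
        · obtain ⟨j, hj, h1⟩ := ih hm
          exact ⟨j, by omega, h1⟩
        · exact ⟨m, by omega, by omega, by have := sum_ediv_two_pow_le v m; omega⟩
    -- At scale `e` all floors are nonpositive because `v i < 2 ^ e`.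
    obtain ⟨j, hj, h1, h2⟩ := key e (Finset.sum_nonpos fun i _ => by
      have : v i / 2 ^ e < 1 := Int.ediv_lt_of_lt_mul (by positivity) (by simpa using hv i)
      omega)
    obtain ⟨r, hr⟩ : ∃ r : ℕ, ∑ i, v i / 2 ^ j = (r + 1 : ℕ) :=
      ⟨(∑ i, v i / 2 ^ j - 1).toNat, by omega⟩
    have hrk : r < k := by omega
    refine ⟨k * j + r, ?_, ?_⟩
    · calc k * j + r < k * j + k := by omega
        _ = k * (j + 1) := by ring
        _ ≤ k * e := Nat.mul_le_mul_left k hj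
    · rw [Nat.mul_add_div hk, Nat.mul_add_mod, Nat.div_eq_of_lt hrk, Nat.mod_eq_of_lt hrk]
      simpa using hr
  · rintro ⟨q, -, hq⟩
    have h1 : ∑ i, v i / 2 ^ (q / k) * 2 ^ (q / k) ≤ ∑ i, v i :=
      Finset.sum_le_sum fun i _ => Int.ediv_mul_le _ (by positivity)
    rw [← Finset.sum_mul, hq] at h1
    exact lt_of_lt_of_le (by positivity) h1

/-! ### Combining the conditions of a clause into one equation -/

variable {k : ℕ} {d : Fin k → ℕ} {l : ℕ}

/-- The part of an affine function that depends on `x_i`. The parameters and the constant are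
attributed to `x_0`. -/
def lin (L : Aff (Var k d l)) (t : Fin l → ℤ) (i : Fin k) (x : Fin (d i) → ℤ) : ℤ :=
  (∑ j, L.1 (.inl ⟨i, j⟩) * x j) + if i.val = 0 then L.2 + ∑ j, L.1 (.inr j) * t j else 0

theorem sum_lin (hk : 0 < k) (L : Aff (Var k d l)) (t : Fin l → ℤ)
    (x : (i : Fin k) → Fin (d i) → ℤ) : ∑ i, lin L t i (x i) = L.value (assign x t) := by
  have h : ∀ (c : ℤ), ∑ i : Fin k, (if i.val = 0 then c else 0) = c := by
    intro c
    rw [Finset.sum_eq_single_of_mem (⟨0, hk⟩ : Fin k) (Finset.mem_univ _)]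
    · simp
    · intro i _ hi
      rw [if_neg]
      exact fun h0 => hi (Fin.ext h0)
  simp only [lin, Finset.sum_add_distrib, h, Aff.value, Fintype.sum_sum_type, Fintype.sum_sigma,
    assign]
  ring

/-- The sum of the absolute values of the coefficients. -/
def Aff.weight (L : Aff (Var k d l)) : ℕ := ∑ v, (L.1 v).natAbs + L.2.natAbs

theorem abs_lin_le (L : Aff (Var k d l)) {t : Fin l → ℤ} {i : Fin k} {x : Fin (d i) → ℤ} {U : ℤ}
    (hU : 1 ≤ U) (hx : ∀ j, |x j| ≤ U) (ht : ∀ j, |t j| ≤ U) :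
    |lin L t i x| ≤ L.weight * U := by
  have hsum : ∀ {n : ℕ} (c y : Fin n → ℤ), (∀ j, |y j| ≤ U) →
      |∑ j, c j * y j| ≤ (∑ j, |c j|) * U := by
    intro n c y hy
    rw [Finset.sum_mul]
    refine (Finset.abs_sum_le_sum_abs _ _).trans (Finset.sum_le_sum fun j _ => ?_)
    rw [abs_mul]
    exact mul_le_mul_of_nonneg_left (hy j) (abs_nonneg _)
  have h1 := hsum (fun j => L.1 (.inl ⟨i, j⟩)) x hx
  have h2 := hsum (fun j => L.1 (.inr j)) t ht
  have h3 : |if i.val = 0 then L.2 + ∑ j, L.1 (.inr j) * t j else 0| ≤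
      (|L.2| + ∑ j, |L.1 (.inr j)|) * U := by
    have h0 : 0 ≤ (|L.2| + ∑ j, |L.1 (.inr j)|) * U := by positivity
    split_ifs
    · refine (abs_add_le _ _).trans ?_
      have := abs_nonneg L.2
      nlinarith
    · simpa using h0
  have h4 : ∑ j, |L.1 (.inl ⟨i, j⟩)| ≤ ∑ i, ∑ j, |L.1 (.inl ⟨i, j⟩)| :=
    Finset.single_le_sum (f := fun i => ∑ j, |L.1 (.inl ⟨i, j⟩)|)
      (fun i _ => Finset.sum_nonneg fun j _ => abs_nonneg _) (Finset.mem_univ i)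
  have h5 : (L.weight : ℤ) = (∑ i, ∑ j, |L.1 (.inl ⟨i, j⟩)|) + ∑ j, |L.1 (.inr j)| + |L.2| := by
    simp [Aff.weight, Fintype.sum_sum_type, Fintype.sum_sigma]
  rw [h5]
  refine (abs_add_le _ _).trans ?_
  nlinarith

/-- The number attached to `x_i` when the `q`-th way to satisfy a clause is tried. -/
def comb (D : ℕ) (R : ℤ) (t : Fin l → ℤ) (i : Fin k) (x : Fin (d i) → ℤ) :
    List (Aff (Var k d l)) → ℕ → ℤ
  | [], _ => 0
  | L :: cl, q => lin L t i x / 2 ^ (q % D / k) - (if i.val = 0 then ((q % D % k + 1 : ℕ) : ℤ) else 0)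
      + R * comb D R t i x cl (q / D)

theorem abs_prefix_le (hk : 0 < k) {v A : ℤ} (i : Fin k) (hv : |v| + k ≤ A) (q m : ℕ) :
    |v / 2 ^ m - (if i.val = 0 then ((q % k + 1 : ℕ) : ℤ) else 0)| ≤ A := by
  have h1 := Int.abs_ediv_le_abs v (2 ^ m)
  have h2 : |if i.val = 0 then ((q % k + 1 : ℕ) : ℤ) else 0| ≤ k := by
    have := Nat.mod_lt q hk
    split_ifs
    · rw [Nat.abs_cast]; exact_mod_cast this
    · simp
  exact (abs_sub _ _).trans (by linarith)

/-- Digits of absolute value at most `A < R` form a number below `R ^ length`: the tail is at most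
`R ^ length - 1` in absolute value, and the gap of `R` left after multiplying by `R` absorbs the
next digit. -/
theorem abs_comb_lt (hk : 0 < k) {D : ℕ} {R A : ℤ} {t : Fin l → ℤ} {i : Fin k}
    {x : Fin (d i) → ℤ} (hA : A < R) {cl : List (Aff (Var k d l))}
    (h : ∀ L ∈ cl, |lin L t i x| + k ≤ A) (q : ℕ) : |comb D R t i x cl q| < R ^ cl.length := by
  induction cl generalizing q with
  | nil => simp [comb]
  | cons L cl ih =>
    have h1 := ih (fun L hL => h L (List.mem_cons_of_mem _ hL)) (q / D)
    have h2 := abs_prefix_le hk i (h L List.mem_cons_self) (q % D) (q % D / k)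
    have hR : 0 ≤ R := (abs_nonneg _).trans (h2.trans hA.le)
    rw [comb]
    refine (abs_add_le _ _).trans_lt ?_
    rw [abs_mul, abs_of_nonneg hR, List.length_cons, pow_succ]
    nlinarith

/-- If the total vanishes, `R` divides `a`, which is too small to be a nonzero multiple. -/
theorem add_mul_eq_zero_iff {a b R : ℤ} (ha : |a| < R) : a + R * b = 0 ↔ a = 0 ∧ b = 0 := by
  constructor
  · intro h
    have : a = 0 := Int.eq_zero_of_abs_lt_dvd ⟨-b, by linarith⟩ ha
    subst this
    have hR : R ≠ 0 := by rintro rfl; simp at ha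
    simpa [hR] using h
  · rintro ⟨rfl, rfl⟩; simp

/-- The base-`D` digits of `q` choose a scale and a right-hand side for each condition. Since the
lowest radix-`R` digit of the sum stays below `R` in absolute value, the combined equation splits
into the separate ones, each of which `sum_pos_iff_exists_sum_ediv` turns into positivity. Using `M`
digits where the clause has fewer conditions is harmless: the surplus digits are ignored. -/
theorem exists_sum_comb_eq_zero_iff (hk : 0 < k) {e D : ℕ} {R A : ℤ} {t : Fin l → ℤ}
    {x : (i : Fin k) → Fin (d i) → ℤ} (he : 0 < e) (hD : D = k * e) (hA : k * A < R)
    {cl : List (Aff (Var k d l))} (h1 : ∀ i, ∀ L ∈ cl, lin L t i (x i) < 2 ^ e)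
    (h2 : ∀ i, ∀ L ∈ cl, |lin L t i (x i)| + k ≤ A) {M : ℕ} (hM : cl.length ≤ M) :
    (∃ q < D ^ M, ∑ i, comb D R t i (x i) cl q = 0) ↔ ∀ L ∈ cl, 0 < L.value (assign x t) := by
  have hD0 : 0 < D := hD ▸ Nat.mul_pos hk he
  induction cl generalizing M with
  | nil => simpa [comb] using ⟨0, pow_pos hD0 M⟩
  | cons L cl ih =>
    obtain ⟨M, rfl⟩ : ∃ M', M = M' + 1 := ⟨M - 1, by simp at hM; omega⟩
    have ih' := ih (fun i L hL => h1 i L (List.mem_cons_of_mem _ hL))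
      (fun i L hL => h2 i L (List.mem_cons_of_mem _ hL)) (M := M) (by simpa using hM)
    have hL := sum_pos_iff_exists_sum_ediv hk (fun i => lin L t i (x i))
      (fun i => h1 i L List.mem_cons_self)
    rw [sum_lin hk] at hL
    rw [← hD] at hL
    rw [List.forall_mem_cons]
    refine Iff.trans ?_ (and_congr hL.symm ih')
    have hone : ∀ c : ℤ, ∑ i : Fin k, (if i.val = 0 then c else 0) = c := by
      intro c
      rw [Finset.sum_eq_single_of_mem (⟨0, hk⟩ : Fin k) (Finset.mem_univ _)]
      · simp
      · intro i _ hi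
        rw [if_neg]
        exact fun h0 => hi (Fin.ext h0)
    have hstep : ∀ q, ∑ i, comb D R t i (x i) (L :: cl) q = 0 ↔
        ∑ i, lin L t i (x i) / 2 ^ (q % D / k) = ((q % D % k + 1 : ℕ) : ℤ) ∧
          ∑ i, comb D R t i (x i) cl (q / D) = 0 := by
      intro q
      simp only [comb]
      rw [Finset.sum_add_distrib, ← Finset.mul_sum, add_mul_eq_zero_iff, Finset.sum_sub_distrib,
        hone, sub_eq_zero]
      -- The digit of the sum consists of `k` summands, each at most `A`; this is why `R` exceeds `k
      -- * A` and not just `A`.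
      refine lt_of_le_of_lt ?_ hA
      refine (Finset.abs_sum_le_sum_abs _ _).trans ?_
      refine (Finset.sum_le_sum fun i _ =>
        abs_prefix_le hk i (h2 i L List.mem_cons_self) (q % D) (q % D / k)).trans ?_
      simp
    constructor
    · rintro ⟨q, hq, h⟩
      obtain ⟨ha, hb⟩ := (hstep q).1 h
      refine ⟨⟨q % D, Nat.mod_lt _ hD0, ha⟩, q / D, ?_, hb⟩
      exact Nat.div_lt_of_lt_mul (by rwa [pow_succ, mul_comm] at hq)
    · rintro ⟨⟨q, hq, ha⟩, r, hr, hb⟩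
      -- The lowest base-`D` digit belongs to `L`, the higher ones to the rest of the clause.
      refine ⟨D * r + q, ?_, (hstep _).2 ?_⟩
      · calc D * r + q < D * r + D := by omega
          _ = D * (r + 1) := by ring
          _ ≤ D * D ^ M := Nat.mul_le_mul_left D hr
          _ = D ^ (M + 1) := by ring
      · rw [Nat.mul_add_div hD0, Nat.mul_add_mod, Nat.div_eq_of_lt hq, Nat.mod_eq_of_lt hq]
        exact ⟨ha, hb⟩

/-! ### Padding to a list of distinct numbers of given length -/

/-- The `p`-th of the numbers `v 0, …, v (m - 1)`, where repeated numbers and numbers beyond the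
end are replaced by the large number `H + p`. -/
def padded (H : ℤ) (m : ℕ) (v : ℕ → ℤ) (p : ℕ) : ℤ :=
  open Classical in if p < m ∧ ∀ p' < p, v p' ≠ v p then v p else H + p

/-- Only first occurrences are kept, fillers exceed all kept numbers, and fillers differ by their
position. This yields the repetition-free lists that instances require. -/
theorem padded_injective {H : ℤ} {m : ℕ} {v : ℕ → ℤ} (hH : ∀ p < m, v p < H) :
    Function.Injective (padded H m v) := by
  have key : ∀ p q, p < q → padded H m v p ≠ padded H m v q := by
    intro p q hpq
    unfold padded
    split_ifs with h1 h2 h2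
    · exact h2.2 p hpq
    · have := hH p h1.1; omega
    · have := hH q h2.1; omega
    · omega
  intro p q h
  rcases lt_trichotomy p q with hlt | heq | hlt
  · exact absurd h (key p q hlt)
  · exact heq
  · exact absurd h.symm (key q p hlt)

/-- A filler is at least `k * H`, while every other summand exceeds `-H`, so a sum with a filler is
positive. Conversely, a zero sum of given numbers survives when each is moved to its first
occurrence, which is never replaced. -/
theorem exists_sum_padded_eq_zero_iff {n : ℕ} {H : ℤ} {m : Fin k → ℕ} {v : Fin k → ℕ → ℤ}
    (hm : ∀ i, m i ≤ n) (hv : ∀ i, ∀ p < m i, |v i p| < H) (hH : 0 < H) :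
    (∃ f : Fin k → ℕ, (∀ i, f i < n) ∧ ∑ i, padded (k * H) (m i) (v i) (f i) = 0) ↔
      ∃ f : Fin k → ℕ, (∀ i, f i < m i) ∧ ∑ i, v i (f i) = 0 := by
  constructor
  · rintro ⟨f, -, hf⟩
    have hlow : ∀ i, 0 ≤ padded (k * H) (m i) (v i) (f i) + H := by
      intro i
      unfold padded
      split_ifs with h
      · have := abs_lt.1 (hv i _ h.1); omega
      · positivity
    have hreal : ∀ i, f i < m i ∧ ∀ p' < f i, v i p' ≠ v i (f i) := by
      intro i
      by_contra h
      -- After adding `H` to every summand the terms are nonnegative with total `k * H`, but a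
      -- filler alone would contribute at least `k * H + H`.
      have h1 := Finset.single_le_sum (fun i _ => hlow i) (Finset.mem_univ i)
      rw [Finset.sum_add_distrib, hf] at h1
      simp only [padded, if_neg h, Finset.sum_const, Finset.card_univ, Fintype.card_fin,
        nsmul_eq_mul] at h1
      have : (0 : ℤ) ≤ f i := by positivity
      linarith
    refine ⟨f, fun i => (hreal i).1, ?_⟩
    rw [← hf]
    exact Finset.sum_congr rfl fun i _ => by rw [padded, if_pos (hreal i)]
  · classical
    rintro ⟨f, hf, h0⟩
    have hex : ∀ i, ∃ p, v i p = v i (f i) := fun i => ⟨f i, rfl⟩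
    have hle : ∀ i, Nat.find (hex i) ≤ f i := fun i => Nat.find_min' _ rfl
    refine ⟨fun i => Nat.find (hex i), fun i => (hle i).trans_lt ((hf i).trans_le (hm i)), ?_⟩
    rw [← h0]
    refine Finset.sum_congr rfl fun i _ => ?_
    rw [padded, if_pos, Nat.find_spec (hex i)]
    refine ⟨(hle i).trans_lt (hf i), fun p' hp' => ?_⟩
    rw [Nat.find_spec (hex i)]
    exact Nat.find_min (hex i) hp'

end FOPZ

namespace FOPZ

/-! ### Positions of the input numbers in memory -/

theorem getD_flatten_ofFn {k : ℕ} (f : Fin k → List ℤ) (i : Fin k) {q : ℕ}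
    (hq : q < (f i).length) :
    (List.ofFn f).flatten.getD ((∑ j, if j < i then (f j).length else 0) + q) 0 =
      (f i).getD q 0 := by
  induction k with
  | zero => exact i.elim0
  | succ k ih =>
    rw [List.ofFn_succ, List.flatten_cons, Fin.sum_univ_succ]
    induction i using Fin.cases with
    | zero =>
      simp only [lt_self_iff_false, if_false, Fin.not_lt_zero, Finset.sum_const_zero, zero_add]
      exact List.getD_append _ _ _ _ hq
    | succ i =>
      rw [if_pos (Fin.succ_pos i), List.getD_append_right _ _ _ _ (by omega)]
      simp only [Fin.succ_lt_succ_iff]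
      rw [← ih (fun j => f j.succ) i hq]
      congr 1
      omega

theorem getD_flatMap_ofFn {m : ℕ} (L : List (Fin m → ℤ)) {p : ℕ} (hp : p < L.length)
    (j : Fin m) : (L.flatMap List.ofFn).getD (p * m + j) 0 = L.getD p 0 j := by
  induction L generalizing p with
  | nil => simp at hp
  | cons x L ih =>
    rw [List.flatMap_cons]
    cases p with
    | zero =>
      rw [List.getD_append _ _ _ _ (by simp)]
      simp
    | succ p =>
      rw [List.getD_append_right _ _ _ _ (by rw [List.length_ofFn, Nat.succ_mul]; omega)]
      rw [List.getD_cons_succ, ← ih (by simpa using hp)]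
      congr 1
      rw [List.length_ofFn, Nat.succ_mul]
      omega

theorem length_flatMap_ofFn {m : ℕ} (L : List (Fin m → ℤ)) :
    (L.flatMap List.ofFn).length = L.length * m := by
  induction L with
  | nil => simp
  | cons x L ih => rw [List.flatMap_cons, List.length_append, ih, List.length_ofFn, List.length_cons]; ring

variable {k : ℕ} {d : Fin k → ℕ} {l : ℕ} (I : Instance k d l)

/-- The position of the first vector of `A_i`. -/
def Instance.start (i : Fin k) : ℕ :=
  k + l + ∑ j, if j < i then (I.pts j).length * d j else 0

theorem Instance.length_code : I.code.length = k + l + ∑ i, (I.pts i).length * d i := by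
  simp [Instance.code, List.length_flatten, List.map_ofFn, List.sum_ofFn, add_assoc]

theorem Instance.getD_code_card (i : Fin k) : I.code.getD i 0 = (I.pts i).length := by
  rw [Instance.code, List.append_assoc, List.getD_append _ _ _ _ (by simp)]
  simp

theorem Instance.getD_code_par (j : Fin l) : I.code.getD (k + j) 0 = I.par j := by
  rw [Instance.code, List.getD_append _ _ _ _ (by simp),
    List.getD_append_right _ _ _ _ (by simp)]
  simp

theorem Instance.getD_code_pts (i : Fin k) {p : ℕ} (hp : p < (I.pts i).length)
    (j : Fin (d i)) :
    I.code.getD (I.start i + p * d i + j) 0 = (I.pts i).getD p 0 j := by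
  rw [Instance.code, List.getD_append_right _ _ _ _ (by simp [Instance.start]; omega)]
  rw [← getD_flatMap_ofFn _ hp]
  rw [← getD_flatten_ofFn (fun i => (I.pts i).flatMap List.ofFn) i (q := p * d i + j)]
  · congr 1
    simp [Instance.start]
    omega
  · rw [length_flatMap_ofFn]
    calc p * d i + j < p * d i + d i := by omega
      _ = (p + 1) * d i := by ring
      _ ≤ _ := Nat.mul_le_mul_right _ hp

theorem Instance.start_add_lt (i : Fin k) {p : ℕ} (hp : p < (I.pts i).length)
    (j : Fin (d i)) : I.start i + p * d i + j < I.code.length := by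
  have h1 : (I.pts i).length * d i ≤ ∑ j, if j < i then 0 else (I.pts j).length * d j := by
    refine le_trans ?_ (Finset.single_le_sum (fun _ _ => Nat.zero_le _) (Finset.mem_univ i))
    simp
  have h2 : ∑ j, (I.pts j).length * d j = (∑ j, if j < i then (I.pts j).length * d j else 0) +
      ∑ j, if j < i then 0 else (I.pts j).length * d j := by
    rw [← Finset.sum_add_distrib]
    exact Finset.sum_congr rfl fun j _ => by split_ifs <;> simp
  have h3 : p * d i + d i ≤ (I.pts i).length * d i := by
    rw [← Nat.succ_mul]; exact Nat.mul_le_mul_right _ hp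
  rw [I.length_code, Instance.start, h2]
  omega

theorem Instance.length_le_size (i : Fin k) : (I.pts i).length ≤ I.size :=
  Finset.le_sup (f := fun i => (I.pts i).length) (Finset.mem_univ i)

theorem Instance.abs_code_le {U : ℕ} (hI : I.BoundedBy U) {v : ℤ} (hv : v ∈ I.code) :
    |v| ≤ max (I.size : ℤ) U := by
  simp only [Instance.code, List.mem_append, List.mem_ofFn, List.mem_flatten,
    exists_exists_eq_and, List.mem_flatMap] at hv
  rcases hv with (⟨i, rfl⟩ | ⟨j, rfl⟩) | ⟨i, x, hx, j, rfl⟩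
  · rw [Nat.abs_cast]
    exact le_max_of_le_left (by exact_mod_cast I.length_le_size i)
  · exact le_max_of_le_right (hI.2 j)
  · exact le_max_of_le_right (hI.1 i x hx j)

theorem Instance.abs_initState_mem_le {U : ℕ} (hI : I.BoundedBy U) (a : ℤ) :
    |(WordRAM.initState I.code).mem a| ≤ max (I.size : ℤ) U := by
  simp only [WordRAM.initState]
  split_ifs
  · by_cases h : a.toNat < I.code.length
    · rw [List.getD_eq_getElem _ _ h]
      exact I.abs_code_le hI (List.getElem_mem h)
    · rw [List.getD_eq_default _ _ (by omega)]; simp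
  · simp

/-! ### Instances of `k`-SUM -/

/-- The instance of `k`-SUM with `A_i = {v i 0, …, v i (n - 1)}`. -/
def sumInstance (k n : ℕ) (v : Fin k → ℕ → ℤ) (hv : ∀ i, Function.Injective (v i)) :
    Instance k (fun _ => 1) 0 where
  pts i := (List.range n).map fun p _ => v i p
  nodup i := List.nodup_range.map fun _ _ h => hv i (congrFun h 0)
  par := Fin.elim0

section
variable {n : ℕ} {v : Fin k → ℕ → ℤ} (hv : ∀ i, Function.Injective (v i))

theorem sumInstance_length (i : Fin k) : ((sumInstance k n v hv).pts i).length = n := by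
  simp [sumInstance]

theorem sumInstance_size (hk : 0 < k) : (sumInstance k n v hv).size = n := by
  have : Nonempty (Fin k) := ⟨⟨0, hk⟩⟩
  simp [Instance.size, sumInstance_length, Finset.sup_const Finset.univ_nonempty]

theorem sumInstance_valid (hk : 0 < k) : (kSum k).valid (sumInstance k n v hv) := fun i => by
  rw [sumInstance_size hv hk, sumInstance_length]

theorem sumInstance_boundedBy {U : ℕ} (h : ∀ i, ∀ p < n, |v i p| ≤ U) :
    (sumInstance k n v hv).BoundedBy U := by
  refine ⟨fun i x hx j => ?_, fun j => j.elim0⟩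
  simp only [sumInstance, List.mem_map, List.mem_range] at hx
  obtain ⟨p, hp, rfl⟩ := hx
  exact h i p hp

theorem sumInstance_yes :
    (kSum k).yes (sumInstance k n v hv) ↔
      ∃ f : Fin k → ℕ, (∀ i, f i < n) ∧ ∑ i, v i (f i) = 0 := by
  constructor
  · rintro ⟨x, hx, h⟩
    simp only [sumInstance, List.mem_map, List.mem_range] at hx
    choose f hf hfx using hx
    refine ⟨f, hf, ?_⟩
    rw [← h]
    exact Finset.sum_congr rfl fun i _ => by rw [← hfx i]
  · rintro ⟨f, hf, h⟩
    refine ⟨fun i _ => v i (f i), fun i => ?_, h⟩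
    simp only [sumInstance, List.mem_map, List.mem_range]
    exact ⟨f i, hf i, rfl⟩

theorem sumInstance_length_code : (sumInstance k n v hv).code.length = k + k * n := by
  simp [Instance.length_code, sumInstance_length]

theorem sumInstance_getD_code_card {i : ℕ} (hi : i < k) :
    (sumInstance k n v hv).code.getD i 0 = n := by
  have := (sumInstance k n v hv).getD_code_card ⟨i, hi⟩
  rwa [sumInstance_length] at this

theorem sumInstance_getD_code (i : Fin k) {p : ℕ} (hp : p < n) :
    (sumInstance k n v hv).code.getD (k + i * n + p) 0 = v i p := by
  have h := (sumInstance k n v hv).getD_code_pts i (p := p) (by rwa [sumInstance_length]) 0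
  have hs : (sumInstance k n v hv).start i = k + i * n := by
    simp only [Instance.start, sumInstance_length, mul_one, add_zero]
    rw [← Finset.sum_filter, Finset.sum_const]
    have : (Finset.univ.filter fun j => j < i) = Finset.Iio i := by ext; simp
    rw [this, Fin.card_Iio, smul_eq_mul]
  rw [hs] at h
  simp only [mul_one, Fin.val_zero, add_zero] at h
  rw [h]
  simp [sumInstance, hp]

end

end FOPZ

namespace FOPZ

open WordRAM

/-! ### The program -/

/-- The constants of the program: `k * lev` times the bit length is the number of ways to satisfy a
condition, `(n + 2) ^ rad` is the radix used to combine conditions, `len` is the number of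
conditions of a clause, `(n + 2) ^ seg` is the unit of memory allocation, and `sub` is a program for
`k`-SUM with registers below `regs` and word bound `(n + 2) ^ exp`. -/
structure Plan where
  lev : ℕ
  rad : ℕ
  len : ℕ
  seg : ℕ
  sub : Cmd
  regs : ℕ
  exp : ℕ

namespace Plan

variable (P : Plan) {k : ℕ} {d : Fin k → ℕ} {l : ℕ}

def baseE : Expr := .var .size + .num 2
def waysE (k : ℕ) : Expr := .num (k * P.lev : ℕ) * .var .bits
def radE : Expr := baseE.pow P.rad
-- Let `Z` be this unit. An attempt owns `(3 * k + 4) * Z` cells from `ptr` on. The `k`-SUM input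
-- starts at `ptr + Z`, with a margin of `Z` on either side for the subroutine. The table of marks
-- of set `i` is centred at `ptr + (3 * i + 4) * Z`, because the values that index it may be
-- negative; tables of radius `Z` at spacing `3 * Z` do not meet.
def segE : Expr := baseE.pow P.seg
def padE (k : ℕ) : Expr := .num k * P.radE.pow P.len + .var .pos

/-- Address of the first vector of `A_i`. -/
def startE (l : ℕ) (d : Fin k → ℕ) (i : Fin k) : Expr :=
  .num (k + l : ℕ) +
    .sum (List.ofFn fun j : Fin k =>
      if j < i then .ld (.num (j : ℕ)) * .num (d j) else .num 0)

def linE (L : Aff (Var k d l)) (i : Fin k) : Expr :=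
  .sum (List.ofFn fun j : Fin (d i) => .num (L.1 (.inl ⟨i, j⟩)) *
      .ld (startE l d i + .var .pos * .num (d i) + .num (j : ℕ))) +
    if i.val = 0 then
      .num L.2 + .sum (List.ofFn fun j : Fin l => .num (L.1 (.inr j)) * .ld (.num (k + j : ℕ)))
    else .num 0

def combE (i : Fin k) : List (Aff (Var k d l)) → Expr → Expr
  | [], _ => .num 0
  | L :: cl, e => (linE L i).shr (e % P.waysE k / .num k) -
        (if i.val = 0 then e % P.waysE k % .num k + .num 1 else .num 0) +
      P.radE * combE i cl (e / P.waysE k)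

/-- Address of a cell of the current instance of `k`-SUM. -/
def outE (e : Expr) : Expr := .var .ptr + P.segE + e

/-- Address of the mark of the current value for the current set. -/
def markE (i : ℕ) : Expr := .var .ptr + .num (3 * i + 4) * P.segE + .var .val

/-- Write the cardinalities of the sets. -/
def header (k : ℕ) : Prog :=
  .range .pos (.num k) (.store (P.outE (.var .pos)) (.var .size))

/-- Compute the next number of the `i`-th set. -/
def entry (cl : List (Aff (Var k d l))) (i : Fin k) : Prog :=
  .ite (.lt (.var .pos) (.ld (.num (i : ℕ))))
    (.seq (.assign .val (P.combE i cl (.var .idx)))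
      (.ite (.ld (P.markE i)) (.assign .val (P.padE k)) (.store (P.markE i) (.num 1))))
    (.assign .val (P.padE k))

/-- Write the numbers of the `i`-th set. -/
def fill (cl : List (Aff (Var k d l))) (i : Fin k) : Prog :=
  .range .pos (.var .size) ((P.entry cl i).seq
    (.store (P.outE (.num k + .num (i : ℕ) * .var .size + .var .pos)) (.var .val)))

/-- Write the first `j` sets. -/
def fills (cl : List (Aff (Var k d l))) : ℕ → Prog
  | 0 => P.header k
  | j + 1 => (fills cl j).seq (if h : j < k then P.fill cl ⟨j, h⟩ else .skip)

/-- Decide the current instance of `k`-SUM. -/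
def solve (k : ℕ) : Prog :=
  .ite (.lt (.var .size) (.num 2))
    (.assign .val (.lt (.num 0) (.var .size) *
      .eq (.sum (List.ofFn fun i : Fin k =>
        .ld (P.outE (.num k + .num (i : ℕ) * .var .size)))) (.num 0)))
    (.call P.sub P.regs P.exp (P.outE (.num 0)) .val)

def body (cl : List (Aff (Var k d l))) : Prog :=
  (P.fills cl k).seq <| (P.solve k).seq <|
    (Prog.assign .acc (.lt (.num 0) (.var .acc + .var .val))).seq
      (.assign .ptr (.var .ptr + .num (3 * k + 4 : ℕ) * P.segE))

def clause (cl : List (Aff (Var k d l))) : Prog :=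
  .range .idx ((P.waysE k).pow P.len) (P.body cl)

def clauses : List (List (Aff (Var k d l))) → Prog
  | [] => .skip
  | cl :: cls => (P.clause cl).seq (clauses cls)

/-- Compute the largest of the first `j` cardinalities. -/
def findSize : ℕ → Prog
  | 0 => .skip
  | j + 1 => (findSize j).seq (.assign .size (.var .size +
      .lt (.var .size) (.ld (.num j)) * (.ld (.num j) - .var .size)))

/-- Compute the bit length. -/
def findBits : Prog :=
  .loop (.shr baseE (.var .bits)) (.assign .bits (.var .bits + .num 1))

/-- The final affine map returns the recorded disjunction for `(x, y) = (0, 1)` and its negation for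
`(1, -1)`. -/
def main (cls : List (List (Aff (Var k d l)))) (x y : ℤ) : Prog :=
  (findSize k).seq <| findBits.seq <| (Prog.assign .ptr P.segE).seq <|
    (P.clauses cls).seq (.assign .acc (.num x + .num y * .var .acc))

end Plan

/-! ### Correctness -/

/-- An execution of the program. -/
structure Run (k : ℕ) (d : Fin k → ℕ) (l : ℕ) where
  plan : Plan
  inst : Instance k d l
  E : ℕ

namespace Run

variable {k : ℕ} {d : Fin k → ℕ} {l : ℕ} (c : Run k d l)

/-- `N` is the base of all word bounds and `W` its bit length. `D` counts the pairs of scale and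
right-hand side for one condition, `R` is the radix, `H` bounds the combined numbers, and `Z` is the
unit of memory. -/
def n : ℕ := c.inst.size
def N : ℤ := c.n + 2
def W : ℕ := Nat.size (c.n + 2)
def D : ℕ := k * c.plan.lev * c.W
def R : ℤ := c.N ^ c.plan.rad
def H : ℤ := c.R ^ c.plan.len
def Z : ℤ := c.N ^ c.plan.seg

/-- The number obtained from the `p`-th element of `A_i` in the `q`-th attempt for `cl`. -/
def value (cl : List (Aff (Var k d l))) (q : ℕ) (i : Fin k) (p : ℕ) : ℤ :=
  comb c.D c.R c.inst.par i ((c.inst.pts i).getD p 0) cl q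

/-- The `i`-th set of the instance of `k`-SUM in the `q`-th attempt for `cl`. -/
def entry (cl : List (Aff (Var k d l))) (q : ℕ) (i : Fin k) : ℕ → ℤ :=
  padded (k * c.H) (c.inst.pts i).length (c.value cl q i)

/-- The `q`-th attempt for `cl` is successful. -/
def Hit (cl : List (Aff (Var k d l))) (q : ℕ) : Prop :=
  ∃ f : Fin k → ℕ, (∀ i, f i < c.n) ∧ ∑ i, c.entry cl q i (f i) = 0

/-- The constants of the program are large enough. -/
structure Fits : Prop where
  pos : 0 < k
  code_le : (c.inst.code.length : ℤ) ≤ c.Z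
  sum_le : (k : ℤ) + k * c.n ≤ c.Z
  pad_le : k * c.H + c.n ≤ c.Z
  exp_le : c.plan.exp ≤ c.plan.seg
  seg_le : c.plan.seg ≤ c.E
  one_le_E : 1 ≤ c.E

theorem two_le_N : 2 ≤ c.N := by simp [N]
theorem one_le_Z : 1 ≤ c.Z := one_le_pow₀ (by linarith [c.two_le_N])
theorem one_le_R : 1 ≤ c.R := one_le_pow₀ (by linarith [c.two_le_N])
theorem one_le_H : 1 ≤ c.H := one_le_pow₀ c.one_le_R

variable {c}

theorem Fits.Z_le (hc : c.Fits) : c.Z ≤ c.N ^ c.E :=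
  pow_le_pow_right₀ (by linarith [c.two_le_N]) hc.seg_le

theorem Fits.H_le (hc : c.Fits) : c.H ≤ k * c.H := by
  have h1 : (1 : ℤ) ≤ k := by exact_mod_cast hc.pos
  nlinarith [c.one_le_H]

variable (c)

/-- The input is still available. -/
structure HasInput (s : Store) : Prop where
  size : s.var .size = c.n
  bits : s.var .bits = c.W
  inp : ∀ a : ℕ, (a : ℤ) < c.Z → s.mem a = c.inst.code.getD a 0

variable {c} {s : Store}

theorem HasInput.eval_baseE (h : c.HasInput s) : Plan.baseE.eval s = c.N := by
  simp [Plan.baseE, h.size, N]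

theorem HasInput.eval_segE (h : c.HasInput s) : c.plan.segE.eval s = c.Z := by
  simp [Plan.segE, h.eval_baseE, Z]

theorem HasInput.eval_radE (h : c.HasInput s) : c.plan.radE.eval s = c.R := by
  simp [Plan.radE, h.eval_baseE, R]

theorem HasInput.eval_waysE (h : c.HasInput s) : (c.plan.waysE k).eval s = c.D := by
  simp [Plan.waysE, h.bits, D]

theorem HasInput.eval_padE (h : c.HasInput s) :
    (c.plan.padE k).eval s = k * c.H + s.var .pos := by
  simp [Plan.padE, h.eval_radE, H]

theorem HasInput.eval_outE (h : c.HasInput s) (e : Expr) :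
    (c.plan.outE e).eval s = s.var .ptr + c.Z + e.eval s := by
  simp [Plan.outE, h.eval_segE]

theorem HasInput.eval_markE (h : c.HasInput s) (i : ℕ) :
    (c.plan.markE i).eval s = s.var .ptr + (3 * i + 4) * c.Z + s.var .val := by
  simp [Plan.markE, h.eval_segE]

theorem Fits.lt_Z (hc : c.Fits) {a : ℕ} (ha : a < c.inst.code.length) : (a : ℤ) < c.Z :=
  lt_of_lt_of_le (by exact_mod_cast ha) hc.code_le

theorem HasInput.card (h : c.HasInput s) (hc : c.Fits) (i : Fin k) :
    s.mem (i : ℕ) = (c.inst.pts i).length := by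
  rw [h.inp _ (hc.lt_Z (by rw [Instance.length_code]; omega)), Instance.getD_code_card]

theorem HasInput.eval_startE (h : c.HasInput s) (hc : c.Fits) (i : Fin k) :
    (Plan.startE l d i).eval s = c.inst.start i := by
  simp only [Plan.startE, Expr.eval_add, Expr.eval_num, Expr.eval_sum_ofFn, Instance.start]
  push_cast
  congr 1
  refine Finset.sum_congr rfl fun j _ => ?_
  split_ifs
  · simp [h.card hc j]
  · simp

theorem HasInput.eval_linE (h : c.HasInput s) (hc : c.Fits) (L : Aff (Var k d l)) {i : Fin k}
    {p : ℕ} (hp : s.var .pos = p) (hpl : p < (c.inst.pts i).length) :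
    (Plan.linE L i).eval s = lin L c.inst.par i ((c.inst.pts i).getD p 0) := by
  have h1 : ∀ j : Fin (d i), s.mem ((c.inst.start i : ℤ) + p * d i + (j : ℕ)) =
      (c.inst.pts i).getD p 0 j := by
    intro j
    have := h.inp _ (hc.lt_Z (c.inst.start_add_lt i hpl j))
    rw [c.inst.getD_code_pts i hpl j] at this
    exact_mod_cast this
  have h2 : ∀ j : Fin l, s.mem ((k : ℤ) + (j : ℕ)) = c.inst.par j := by
    intro j
    have := h.inp (k + j) (hc.lt_Z (by rw [Instance.length_code]; omega))
    rw [c.inst.getD_code_par j] at this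
    exact_mod_cast this
  simp only [Plan.linE, Expr.eval_add, Expr.eval_sum_ofFn, Expr.eval_mul, Expr.eval_num,
    Expr.eval_ld, h.eval_startE hc, Expr.eval_var, hp, h1, lin]
  congr 1
  split_ifs
  · simp [h2]
  · simp

theorem HasInput.eval_combE (h : c.HasInput s) (hc : c.Fits) {i : Fin k} {p : ℕ}
    (hp : s.var .pos = p) (hpl : p < (c.inst.pts i).length) (cl : List (Aff (Var k d l)))
    (e : Expr) (q : ℕ) (he : e.eval s = q) :
    (c.plan.combE i cl e).eval s =
      comb c.D c.R c.inst.par i ((c.inst.pts i).getD p 0) cl q := by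
  induction cl generalizing e q with
  | nil => rfl
  | cons L cl ih =>
    have h1 : ((q : ℤ) % c.D / k).toNat = q % c.D / k := by
      rw [show (q : ℤ) % c.D / k = ((q % c.D / k : ℕ) : ℤ) by push_cast; rfl, Int.toNat_natCast]
    simp only [Plan.combE, comb, Expr.eval_add, Expr.eval_sub, Expr.eval_mul, Expr.eval_shr,
      h.eval_linE hc L hp hpl, h.eval_radE, Expr.eval_div, Expr.eval_mod, h.eval_waysE, he,
      Expr.eval_num, h1]
    rw [ih (e / c.plan.waysE k) (q / c.D) (by simp [he, h.eval_waysE])]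
    congr 2
    split_ifs
    · simp [he, h.eval_waysE]
    · simp

end Run

end FOPZ

/-! ### Writing one instance of `k`-SUM into memory -/

namespace FOPZ

open WordRAM

namespace Run

variable {k : ℕ} {d : Fin k → ℕ} {l : ℕ} (c : Run k d l)

/-- The first `m` words `code` of the current instance of `k`-SUM have been written, and the marks
of the sets from the `j`-th on are unused. -/
structure Stage (p₀ a₀ q₀ : ℤ) (code : List ℤ) (j m : ℕ) (s : Store) : Prop
    extends c.HasInput s where
  ptr : s.var .ptr = p₀
  acc : s.var .acc = a₀
  idx : s.var .idx = q₀
  out : ∀ b, |b| ≤ c.Z →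
    s.mem (p₀ + c.Z + b) = if 0 ≤ b ∧ b < m then code.getD b.toNat 0 else 0
  above : ∀ a, p₀ + (3 * j + 3) * c.Z ≤ a → s.mem a = 0

/-- The marks for the `i`-th set are those of the first `p` numbers. -/
def Marks (p₀ : ℤ) (cl : List (Aff (Var k d l))) (q : ℕ) (i : Fin k) (p : ℕ) (s : Store) : Prop :=
  ∀ h, |h| ≤ c.Z → s.mem (p₀ + (3 * (i : ℕ) + 4) * c.Z + h) =
    open Classical in
    if ∃ p' < p, p' < (c.inst.pts i).length ∧ c.value cl q i p' = h then 1 else 0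

variable {c} {p₀ a₀ q₀ : ℤ} {code : List ℤ} {j m : ℕ} {s : Store}
  {cl : List (Aff (Var k d l))} {q : ℕ} {i : Fin k} {p : ℕ}

theorem Stage.set_pos (h : c.Stage p₀ a₀ q₀ code j m s) (v : ℤ) :
    c.Stage p₀ a₀ q₀ code j m (s.set .pos v) :=
  ⟨⟨by simpa using h.size, by simpa using h.bits, h.inp⟩, by simpa using h.ptr,
    by simpa using h.acc, by simpa using h.idx, h.out, h.above⟩

theorem Stage.set_val (h : c.Stage p₀ a₀ q₀ code j m s) (v : ℤ) :
    c.Stage p₀ a₀ q₀ code j m (s.set .val v) :=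
  ⟨⟨by simpa using h.size, by simpa using h.bits, h.inp⟩, by simpa using h.ptr,
    by simpa using h.acc, by simpa using h.idx, h.out, h.above⟩

theorem Stage.put_out (h : c.Stage p₀ a₀ q₀ code j m s) (hp₀ : c.Z ≤ p₀) (hm : (m : ℤ) ≤ c.Z)
    {v : ℤ} (hv : code.getD m 0 = v) :
    c.Stage p₀ a₀ q₀ code j (m + 1) (s.put (p₀ + c.Z + m) v) := by
  have hZ := c.one_le_Z
  refine ⟨⟨h.size, h.bits, fun a ha => ?_⟩, h.ptr, h.acc, h.idx, fun b hb => ?_, fun a ha => ?_⟩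
  · rw [Store.put_mem, if_neg (by omega), h.inp a ha]
  · rw [Store.put_mem]
    by_cases hbm : b = m
    · subst hbm
      rw [if_pos rfl, if_pos ⟨by omega, by push_cast; omega⟩, Int.toNat_natCast, hv]
    · rw [if_neg (by omega), h.out b hb]
      congr 1
      push_cast
      apply propext
      omega
  · rw [Store.put_mem, if_neg, h.above a ha]
    have : (0 : ℤ) ≤ j * c.Z := by positivity
    intro h1
    linarith

/-- The table of the `j`-th set lies above the window `[p₀, p₀ + 2 * Z]` of the written instance and
below `p₀ + (3 * (j + 1) + 3) * Z`, from where on memory must remain zero. -/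
theorem Stage.put_mark (h : c.Stage p₀ a₀ q₀ code (j + 1) m s) (hp₀ : c.Z ≤ p₀) {b v : ℤ}
    (hb : |b| ≤ c.Z) :
    c.Stage p₀ a₀ q₀ code (j + 1) m (s.put (p₀ + (3 * j + 4) * c.Z + b) v) := by
  have hZ := c.one_le_Z
  have hj : (0 : ℤ) ≤ j * c.Z := by positivity
  obtain ⟨hb1, hb2⟩ := abs_le.1 hb
  refine ⟨⟨h.size, h.bits, fun a ha => ?_⟩, h.ptr, h.acc, h.idx, fun b' hb' => ?_,
    fun a ha => ?_⟩
  · rw [Store.put_mem, if_neg (by intro h1; linarith), h.inp a ha]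
  · obtain ⟨hb1', hb2'⟩ := abs_le.1 hb'
    rw [Store.put_mem, if_neg (by intro h1; linarith), h.out b' hb']
  · rw [Store.put_mem, if_neg, h.above a ha]
    push_cast at ha
    intro h1
    linarith

theorem Stage.next (h : c.Stage p₀ a₀ q₀ code j m s) : c.Stage p₀ a₀ q₀ code (j + 1) m s := by
  refine ⟨h.toHasInput, h.ptr, h.acc, h.idx, h.out, fun a ha => h.above a ?_⟩
  have hZ := c.one_le_Z
  push_cast at ha
  linarith

/-- The table of the `i`-th set begins exactly where the memory is still known to be zero, so it
needs no initialisation. -/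
theorem Stage.marks_zero (h : c.Stage p₀ a₀ q₀ code i m s) : c.Marks p₀ cl q i 0 s := by
  intro b hb
  obtain ⟨hb1, hb2⟩ := abs_le.1 hb
  rw [h.above _ (by linarith)]
  simp

theorem Marks.put_out (h : c.Marks p₀ cl q i p s) {b v : ℤ} (hb : |b| ≤ c.Z) :
    c.Marks p₀ cl q i p (s.put (p₀ + c.Z + b) v) := by
  intro b' hb'
  obtain ⟨hb1, hb2⟩ := abs_le.1 hb
  obtain ⟨hb1', hb2'⟩ := abs_le.1 hb'
  have hZ := c.one_le_Z
  have hj : (0 : ℤ) ≤ (i : ℕ) * c.Z := by positivity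
  rw [Store.put_mem, if_neg (by intro h1; linarith), h b' hb']

/-- Like the other time functions, this depends on the program and not on the instance, so it ends
up in the constant of the `O`-bound. -/
def headerTime (P : Plan) (k : ℕ) : ℕ := k * ((P.outE (.var .pos)).cost + 14) + 11

theorem header_tr {G : Prop} (hc : c.Fits) (hp₀ : c.Z ≤ p₀)
    (hcode : ∀ b < k, code.getD b 0 = c.n) (h : c.Stage p₀ a₀ q₀ code 0 0 s) :
    Tr G c.N c.E (c.plan.header k) s (headerTime c.plan k)
      (c.Stage p₀ a₀ q₀ code 0 k) := by
  have hk : (k : ℤ) ≤ c.Z := le_trans (by have : (0 : ℤ) ≤ k * c.n := by positivity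
                                          linarith) hc.sum_le
  have hn : (c.n : ℤ) ≤ c.Z := le_trans (by have : (0 : ℤ) ≤ k * c.H := by
                                              have := c.one_le_H; positivity
                                            linarith) hc.pad_le
  refine (Tr.range c.two_le_N (J := k) (t := (c.plan.outE (.var .pos)).cost + 3)
    (hk.trans hc.Z_le) (fun p s => s.var .pos = p ∧ c.Stage p₀ a₀ q₀ code 0 p s)
    ⟨by simp, h.set_pos 0⟩ (by simp) (fun _ _ h => h.1) ?_ (fun _ h => h.2)).mono ?_
    fun _ _ h => h
  · rintro p hp s ⟨hpos, hs⟩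
    refine Tr.store c.two_le_N ?_ ⟨hpos, by simp, ?_⟩
    · rw [Expr.eval_var, hs.size, Nat.abs_cast]; exact hn.trans hc.Z_le
    · apply Stage.set_pos
      rw [hs.eval_outE, Expr.eval_var, Expr.eval_var, hs.ptr, hpos, hs.size]
      exact hs.put_out hp₀ (by omega) (hcode p hp)
  · simp only [headerTime, Expr.cost]
    have : (c.plan.outE (.var .pos)).cost + 3 + 1 + 10 = (c.plan.outE (.var .pos)).cost + 14 := by
      omega
    rw [this]

def entryTime (P : Plan) (cl : List (Aff (Var k d l))) (i : Fin k) : ℕ :=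
  (P.combE i cl (.var .idx)).cost + 2 * (P.markE i).cost + 2 * (P.padE k).cost + 20

/-- Repetitions are detected with a table addressed directly by the value. The table has polynomial
size, but only the cells in use are ever touched, so an entry costs a constant number of steps and
no sorting is needed. -/
theorem entry_tr {G : Prop} (hc : c.Fits)
    (hval : ∀ p < (c.inst.pts i).length, |c.value cl q i p| < c.H) (hp₀ : c.Z ≤ p₀)
    (h : c.Stage p₀ a₀ q code (i + 1) m s) (hM : c.Marks p₀ cl q i p s) (hpos : s.var .pos = p)
    (hp : p < c.n) :
    Tr G c.N c.E (c.plan.entry cl i) s (entryTime c.plan cl i) fun s' =>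
      s'.var .pos = p ∧ c.Stage p₀ a₀ q code (i + 1) m s' ∧ c.Marks p₀ cl q i (p + 1) s' ∧
        s'.var .val = c.entry cl q i p := by
  have hkH : 0 ≤ (k : ℤ) * c.H := by have := c.one_le_H; positivity
  have hHZ : c.H ≤ c.Z := by have := hc.H_le; have := hc.pad_le; linarith
  have hcard : (Expr.ld (.num (i : ℕ))).eval s = (c.inst.pts i).length := h.card hc i
  have hpadB : |(k : ℤ) * c.H + p| ≤ c.N ^ c.E := by
    rw [abs_of_nonneg (by positivity)]
    refine le_trans ?_ (hc.pad_le.trans hc.Z_le)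
    have : (p : ℤ) ≤ c.n := by exact_mod_cast hp.le
    linarith
  have hpad : ∀ {s' : Store}, c.Stage p₀ a₀ q code (i + 1) m s' → c.Marks p₀ cl q i (p + 1) s' →
      s'.var .pos = p → c.entry cl q i p = k * c.H + p →
      Tr G c.N c.E (.assign .val (c.plan.padE k)) s' ((c.plan.padE k).cost + 2) fun s' =>
        s'.var .pos = p ∧ c.Stage p₀ a₀ q code (i + 1) m s' ∧ c.Marks p₀ cl q i (p + 1) s' ∧
          s'.var .val = c.entry cl q i p := by
    intro s' h' hM' hpos' hent
    have hev : (c.plan.padE k).eval s' = k * c.H + p := by rw [h'.eval_padE, hpos']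
    refine Tr.assign c.two_le_N (by rw [hev]; exact hpadB)
      ⟨by simpa using hpos', h'.set_val _, hM', ?_⟩
    rw [hev, hent]; simp
  have hlong : p < (c.inst.pts i).length → Tr G c.N c.E
      (.seq (.assign .val (c.plan.combE i cl (.var .idx)))
        (.ite (.ld (c.plan.markE i)) (.assign .val (c.plan.padE k))
          (.store (c.plan.markE i) (.num 1)))) s
      ((c.plan.combE i cl (.var .idx)).cost + 2 + ((Expr.ld (c.plan.markE i)).cost +
        (max ((c.plan.padE k).cost + 2) ((c.plan.markE i).cost + ((Expr.num 1).cost + 1)) + 1)))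
      fun s' => s'.var .pos = p ∧ c.Stage p₀ a₀ q code (i + 1) m s' ∧
        c.Marks p₀ cl q i (p + 1) s' ∧ s'.var .val = c.entry cl q i p := by
    intro hpl
    have hev : (c.plan.combE i cl (.var .idx)).eval s = c.value cl q i p :=
      h.eval_combE hc hpos hpl cl _ q h.idx
    have hvZ : |c.value cl q i p| ≤ c.Z := (hval p hpl).le.trans hHZ
    refine Tr.seq (Tr.assign c.two_le_N (by rw [hev]; exact hvZ.trans hc.Z_le) ?_)
    rw [hev]
    have h1 := h.set_val (c.value cl q i p)
    have hM1 : c.Marks p₀ cl q i p (s.set .val (c.value cl q i p)) := hM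
    have haddr : (c.plan.markE i).eval (s.set .val (c.value cl q i p)) =
        p₀ + (3 * (i : ℕ) + 4) * c.Z + c.value cl q i p := by
      rw [h1.eval_markE, h1.ptr]; simp
    have hload : (Expr.ld (c.plan.markE i)).eval (s.set .val (c.value cl q i p)) =
        open Classical in if ∃ p' < p, p' < (c.inst.pts i).length ∧
          c.value cl q i p' = c.value cl q i p then 1 else 0 := by
      rw [Expr.eval_ld, haddr, hM1 _ hvZ]
    refine Tr.ite c.two_le_N (fun hne => ?_) (fun heq => ?_)
    · have hex : ∃ p' < p, p' < (c.inst.pts i).length ∧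
          c.value cl q i p' = c.value cl q i p := by
        by_contra hno; rw [hload, if_neg hno] at hne; exact hne rfl
      -- A repeated value is already marked, so the set of marked values does not change.
      refine hpad h1 ?_ (by simpa using hpos) ?_
      · intro b hb
        rw [hM1 b hb]
        congr 1
        apply propext
        constructor
        · rintro ⟨p', h2, h3⟩; exact ⟨p', by omega, h3⟩
        · rintro ⟨p', h2, h3, h4⟩
          by_cases hpp : p' = p
          · subst hpp
            obtain ⟨p'', h5, h6, h7⟩ := hex
            exact ⟨p'', h5, h6, h7.trans h4⟩
          · exact ⟨p', by omega, h3, h4⟩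
      · obtain ⟨p', h2, _, h4⟩ := hex
        rw [Run.entry, padded, if_neg]
        rintro ⟨_, h5⟩
        exact h5 p' h2 h4
    · have hex : ¬ ∃ p' < p, p' < (c.inst.pts i).length ∧
          c.value cl q i p' = c.value cl q i p := by
        intro hex; rw [hload, if_pos hex] at heq; exact one_ne_zero heq
      refine Tr.store c.two_le_N (by simpa using one_le_pow₀ (by linarith [c.two_le_N])) ?_
      rw [haddr, Expr.eval_num]
      refine ⟨by simpa using hpos, h1.put_mark hp₀ hvZ, ?_, ?_⟩
      · intro b hb
        rw [Store.put_mem]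
        by_cases hbv : b = c.value cl q i p
        · rw [if_pos (by rw [hbv]), if_pos ⟨p, by omega, hpl, hbv.symm⟩]
        · rw [if_neg (by intro h2; exact hbv (by linarith)), hM1 b hb]
          congr 1
          apply propext
          constructor
          · rintro ⟨p', h2, h3⟩; exact ⟨p', by omega, h3⟩
          · rintro ⟨p', h2, h3, h4⟩
            have hpp : p' ≠ p := by rintro rfl; exact hbv h4.symm
            exact ⟨p', by omega, h3, h4⟩
      · rw [Run.entry, padded, if_pos]
        · simp
        · refine ⟨hpl, fun p' h2 h3 => hex ⟨p', h2, by omega, h3⟩⟩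
  refine (Tr.ite c.two_le_N (t' := (c.plan.padE k).cost + 2) (fun hne => hlong ?_)
    (fun heq => hpad h ?_ hpos ?_)).mono ?_ fun _ _ h => h
  · by_contra hno
    rw [Expr.eval_lt, hcard, Expr.eval_var, hpos, if_neg (by exact_mod_cast hno)] at hne
    exact hne rfl
  · have hno : ¬ p < (c.inst.pts i).length := by
      intro hlt
      rw [Expr.eval_lt, hcard, Expr.eval_var, hpos, if_pos (by exact_mod_cast hlt)] at heq
      exact one_ne_zero heq
    intro b hb
    rw [hM b hb]
    congr 1
    apply propext
    constructor
    · rintro ⟨p', h2, h3⟩; exact ⟨p', by omega, h3⟩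
    · rintro ⟨p', h2, h3, h4⟩; exact ⟨p', by omega, h3, h4⟩
  · rw [Run.entry, padded, if_neg]
    rintro ⟨hlt, -⟩
    rw [Expr.eval_lt, hcard, Expr.eval_var, hpos, if_pos (by exact_mod_cast hlt)] at heq
    exact one_ne_zero heq
  · simp only [entryTime, Expr.lt, Expr.cost]
    omega

def fillTime (P : Plan) (cl : List (Aff (Var k d l))) (i : Fin k) : ℕ :=
  entryTime P cl i +
    (P.outE (.num k + .num (i : ℕ) * .var .size + .var .pos)).cost + 30

theorem fill_tr {G : Prop} (hc : c.Fits)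
    (hval : ∀ p < (c.inst.pts i).length, |c.value cl q i p| < c.H) (hp₀ : c.Z ≤ p₀)
    (hcode : ∀ p < c.n, code.getD (k + i * c.n + p) 0 = c.entry cl q i p)
    (h : c.Stage p₀ a₀ q code i (k + i * c.n) s) :
    Tr G c.N c.E (c.plan.fill cl i) s ((c.n + 1) * fillTime c.plan cl i)
      (c.Stage p₀ a₀ q code (i + 1) (k + (i + 1) * c.n)) := by
  have hkH : 0 ≤ (k : ℤ) * c.H := by have := c.one_le_H; positivity
  have hHZ : k * c.H ≤ c.Z := by have := hc.pad_le; linarith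
  have hn : (c.n : ℤ) ≤ c.Z := by have := hc.pad_le; linarith
  refine (Tr.range c.two_le_N (J := c.n) (t := entryTime c.plan cl i +
      ((c.plan.outE (.num k + .num (i : ℕ) * .var .size + .var .pos)).cost + 3))
    (hn.trans hc.Z_le) (fun p s => s.var .pos = p ∧
      c.Stage p₀ a₀ q code (i + 1) (k + i * c.n + p) s ∧ c.Marks p₀ cl q i p s)
    ⟨by simp, h.next.set_pos 0, h.marks_zero⟩ (fun _ _ h => by simpa using h.2.1.size)
    (fun _ _ h => h.1) ?_ (fun s h => ?_)).mono ?_ fun _ _ h => h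
  · rintro p hp s ⟨hpos, hs, hM⟩
    refine Tr.seq ((entry_tr hc hval hp₀ hs hM hpos hp).mono le_rfl ?_)
    rintro s' hb ⟨hpos', hs', hM', hv⟩
    refine Tr.store c.two_le_N (hb.var _) ⟨hpos', by simp, ?_, ?_⟩
    · apply Stage.set_pos
      have he : (c.plan.outE (.num k + .num (i : ℕ) * .var .size + .var .pos)).eval s' =
          p₀ + c.Z + ((k + i * c.n + p : ℕ) : ℤ) := by
        rw [hs'.eval_outE, hs'.ptr]
        simp [hs'.size, hpos']
      rw [he, Expr.eval_var, hv]
      refine hs'.put_out hp₀ ?_ (hcode p hp)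
      refine le_trans ?_ hc.sum_le
      have : k + i * c.n + p ≤ k + k * c.n := by
        have : (i + 1) * c.n ≤ k * c.n := Nat.mul_le_mul_right _ i.2
        rw [Nat.succ_mul] at this
        omega
      exact_mod_cast this
    · have he : (c.plan.outE (.num k + .num (i : ℕ) * .var .size + .var .pos)).eval s' =
          p₀ + c.Z + ((k + i * c.n + p : ℕ) : ℤ) := by
        rw [hs'.eval_outE, hs'.ptr]
        simp [hs'.size, hpos']
      rw [he]
      refine Marks.put_out hM' ?_
      rw [Nat.abs_cast]
      refine le_trans ?_ hc.sum_le
      have : k + i * c.n + p ≤ k + k * c.n := by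
        have : (i + 1) * c.n ≤ k * c.n := Nat.mul_le_mul_right _ i.2
        rw [Nat.succ_mul] at this
        omega
      exact_mod_cast this
  · have := h.2.1
    rwa [add_assoc, ← Nat.succ_mul] at this
  · simp only [fillTime, Expr.cost]
    rw [Nat.succ_mul, add_assoc]
    refine Nat.add_le_add (Nat.mul_le_mul_left _ (by omega)) (by omega)

def fillsTime (P : Plan) (cl : List (Aff (Var k d l))) : ℕ → ℕ
  | 0 => headerTime P k
  | j + 1 => fillsTime P cl j + if h : j < k then fillTime P cl ⟨j, h⟩ else 1

theorem fills_tr {G : Prop} (hc : c.Fits)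
    (hval : ∀ i, ∀ p < (c.inst.pts i).length, |c.value cl q i p| < c.H) (hp₀ : c.Z ≤ p₀)
    (hcode₀ : ∀ b < k, code.getD b 0 = c.n)
    (hcode : ∀ i : Fin k, ∀ p < c.n, code.getD (k + i * c.n + p) 0 = c.entry cl q i p)
    (h : c.Stage p₀ a₀ q code 0 0 s) {j : ℕ} (hj : j ≤ k) :
    Tr G c.N c.E (c.plan.fills cl j) s ((c.n + 1) * fillsTime c.plan cl j)
      (c.Stage p₀ a₀ q code j (k + j * c.n)) := by
  induction j with
  | zero =>
    refine (header_tr hc hp₀ hcode₀ h).mono ?_ fun s _ hs => by simpa using hs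
    rw [fillsTime]
    exact Nat.le_mul_of_pos_left _ (by omega)
  | succ j ih =>
    rw [Plan.fills, fillsTime, dif_pos (by omega), dif_pos (by omega), Nat.mul_add]
    refine Tr.seq ((ih (by omega)).mono le_rfl fun s' _ hs' => ?_)
    exact fill_tr (i := ⟨j, by omega⟩) hc (hval _) hp₀ (hcode _) hs'

end Run

end FOPZ

/-! ### Deciding one attempt -/

namespace FOPZ

open WordRAM

/-- `1` for a true and `0` for a false proposition. -/
noncomputable def truth (A : Prop) : ℤ := open Classical in if A then 1 else 0

theorem abs_truth_le (A : Prop) : |truth A| ≤ 1 := by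
  unfold truth; split_ifs <;> simp

namespace Run

variable {k : ℕ} {d : Fin k → ℕ} {l : ℕ} (c : Run k d l)

/-- The input is available, and the memory from `p₀` on is unused. -/
structure Ready (p₀ : ℤ) (s : Store) : Prop extends c.HasInput s where
  ptr : s.var .ptr = p₀
  zero : ∀ a, p₀ ≤ a → s.mem a = 0

/-- The program `c.plan.sub` decides the current instance of `k`-SUM. -/
def SubSpec (G : Prop) (T : ℕ) (cl : List (Aff (Var k d l))) (q : ℕ) (code : List ℤ) : Prop :=
  ∃ t S, Exec (c.N ^ c.plan.exp) c.plan.sub (initState code) t S ∧ (G → t ≤ T) ∧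
    S.reg 0 = truth (c.Hit cl q)

/-- `code` is the input of `k`-SUM for the `q`-th attempt for `cl`. -/
structure IsCode (cl : List (Aff (Var k d l))) (q : ℕ) (code : List ℤ) : Prop where
  length : code.length = k + k * c.n
  card : ∀ b < k, code.getD b 0 = c.n
  entry : ∀ i : Fin k, ∀ p < c.n, code.getD (k + i * c.n + p) 0 = c.entry cl q i p

variable {c} {p₀ a₀ q₀ : ℤ} {code : List ℤ} {s : Store} {cl : List (Aff (Var k d l))} {q T : ℕ}
  {G : Prop} {A : Prop}

theorem Ready.stage (h : c.Ready p₀ s) :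
    c.Stage p₀ (s.var .acc) (s.var .idx) code 0 0 s := by
  have hZ := c.one_le_Z
  refine ⟨h.toHasInput, h.ptr, rfl, rfl, fun b hb => ?_, fun a ha => h.zero a ?_⟩
  · have := abs_le.1 hb
    rw [h.zero _ (by omega), if_neg (by push_cast; omega)]
  · push_cast at ha
    linarith

def solveTime (P : Plan) (k : ℕ) : ℕ :=
  (Expr.sum (List.ofFn fun i : Fin k =>
    .ld (P.outE (.num k + .num (i : ℕ) * .var .size)))).cost + (P.outE (.num 0)).cost + P.regs + 30

/-- The given program is specified only for numbers up to a power of `n`. For `n ≤ 1` such a power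
is at most 1, so these sizes are treated directly. -/
theorem hit_of_size_lt_two (hk : 0 < k) (hn : c.n < 2) (cl : List (Aff (Var k d l))) (q : ℕ) :
    c.Hit cl q ↔ c.n = 1 ∧ ∑ i, c.entry cl q i 0 = 0 := by
  constructor
  · rintro ⟨f, hf, h⟩
    have h1 := hf ⟨0, hk⟩
    have hf0 : ∀ i, f i = 0 := fun i => by have := hf i; omega
    refine ⟨by omega, ?_⟩
    rw [← h]
    exact Finset.sum_congr rfl fun i _ => by rw [hf0]
  · rintro ⟨h1, h⟩
    exact ⟨fun _ => 0, fun _ => h1 ▸ Nat.one_pos, h⟩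

theorem solve_tr (hc : c.Fits) (hregs : c.plan.sub.RegsBelow c.plan.regs)
    (hregs0 : 0 < c.plan.regs) (hcode : c.IsCode cl q code)
    (hsub : 2 ≤ c.n → c.SubSpec G T cl q code) (hp₀ : c.Z ≤ p₀)
    (h : c.Stage p₀ a₀ q₀ code k (k + k * c.n) s) :
    Tr G c.N c.E (c.plan.solve k) s (solveTime c.plan k + 2 * T) fun s' =>
      c.HasInput s' ∧ s'.var .ptr = p₀ ∧ s'.var .acc = a₀ ∧ s'.var .idx = q₀ ∧
        s'.var .val = truth (c.Hit cl q) ∧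
        ∀ a, p₀ + (3 * k + 3) * c.Z ≤ a → s'.mem a = 0 := by
  classical
  have hZ := c.one_le_Z
  have hE : (1 : ℤ) ≤ c.N ^ c.E := hZ.trans hc.Z_le
  have hev : (Expr.lt (.var .size) (.num 2)).eval s = if c.n < 2 then 1 else 0 := by
    rw [Expr.eval_lt, Expr.eval_var, Expr.eval_num, h.size]
    congr 1
    apply propext
    omega
  refine (Tr.ite c.two_le_N
    (t := (Expr.lt (.num 0) (.var .size) *
      .eq (.sum (List.ofFn fun i : Fin k =>
        .ld (c.plan.outE (.num k + .num (i : ℕ) * .var .size)))) (.num 0)).cost + 2)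
    (t' := 2 * T + (c.plan.outE (.num 0)).cost + c.plan.regs + 4)
    (fun hne => ?_) (fun heq => ?_)).mono ?_ fun _ _ h => h
  · have hn : c.n < 2 := by
      by_contra hno; rw [hev, if_neg hno] at hne; exact hne rfl
    have hval : (Expr.lt (.num 0) (.var .size) *
      .eq (.sum (List.ofFn fun i : Fin k =>
        .ld (c.plan.outE (.num k + .num (i : ℕ) * .var .size)))) (.num 0)).eval s =
        truth (c.Hit cl q) := by
      simp only [Expr.eval_mul, Expr.eval_lt, Expr.eval_num, Expr.eval_var, Expr.eval_eq,
        Expr.eval_sum_ofFn, Expr.eval_ld, h.eval_outE, Expr.eval_add, h.size, h.ptr]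
      have hsize : c.n = 1 ∨ c.n = 0 := by omega
      rcases hsize with h1 | h0
      · have hmem : ∀ i : Fin k, s.mem (p₀ + c.Z + ((k : ℤ) + (i : ℕ) * (c.n : ℤ))) =
            c.entry cl q i 0 := by
          intro i
          have hle : (k : ℤ) + (i : ℕ) * (c.n : ℤ) < k + k * c.n := by
            rw [h1]; have := i.2; push_cast; omega
          have hnn : (0 : ℤ) ≤ (k : ℤ) + (i : ℕ) * (c.n : ℤ) := by positivity
          rw [h.out _ (by rw [abs_of_nonneg hnn]; exact hle.le.trans hc.sum_le),
            if_pos ⟨hnn, by exact_mod_cast hle⟩]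
          rw [← hcode.entry i 0 (by omega)]
          congr 1
        simp only [hmem]
        simp [truth, hit_of_size_lt_two hc.pos hn, h1]
      · simp [truth, hit_of_size_lt_two hc.pos hn, h0]
    refine Tr.assign c.two_le_N ?_ ?_
    · rw [hval]; exact (abs_truth_le _).trans hE
    · rw [hval]
      exact ⟨(h.set_val _).toHasInput, by simpa using h.ptr, by simpa using h.acc,
        by simpa using h.idx, by simp, fun a ha => h.above a ha⟩
  · have hn : 2 ≤ c.n := by
      by_contra hno; rw [hev, if_pos (by omega)] at heq; exact one_ne_zero heq
    obtain ⟨t, S, he, ht, hS⟩ := hsub hn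
    have haddr : (c.plan.outE (.num 0)).eval s = p₀ + c.Z := by
      rw [h.eval_outE, h.ptr, Expr.eval_num, add_zero]
    have hexp : c.N ^ c.plan.exp ≤ c.Z :=
      pow_le_pow_right₀ (by linarith [c.two_le_N]) hc.exp_le
    refine Tr.call c.two_le_N hregs hregs0 he (fun _ => rfl) (hc.exp_le.trans hc.seg_le)
      (fun a ha => ?_) ht fun s' hvar hmem => ?_
    · rw [haddr, h.out a (ha.trans hexp)]
      simp only [initState]
      by_cases ha0 : 0 ≤ a
      · by_cases ham : a < ((k + k * c.n : ℕ) : ℤ)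
        · rw [if_pos ⟨ha0, ham⟩, if_pos ha0]
        · rw [if_neg (fun h => ham h.2), if_pos ha0, List.getD_eq_default]
          rw [hcode.length]; omega
      · rw [if_neg (fun h => ha0 h.1), if_neg ha0]
    · rw [haddr] at hmem
      refine ⟨⟨by simpa [hvar] using h.size, by simpa [hvar] using h.bits, fun a ha => ?_⟩,
        by simpa [hvar] using h.ptr, by simpa [hvar] using h.acc, by simpa [hvar] using h.idx,
        by simpa using hS, fun a ha => ?_⟩
      -- The original input lies below `Z ≤ p₀`, at distance more than `Z` from the centre `p₀ + Z`
      -- of the window.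
      · rw [Store.set_mem, hmem _ ?_, h.inp a ha]
        rw [abs_of_nonpos (by omega)]; omega
      · have hk : (0 : ℤ) ≤ k * c.Z := by positivity
        rw [Store.set_mem, hmem _ ?_, h.above a ha]
        rw [abs_of_nonneg (by linarith)]; linarith
  · simp only [solveTime, Expr.cost, Expr.lt, Expr.eq]
    change 2 + 1 + 1 + (max ((1 + (2 + 1)) + (_ + (1 + 1) + 1) + 2) _ + 1) ≤ _
    omega

def bodyTime (P : Plan) (cl : List (Aff (Var k d l))) : ℕ :=
  fillsTime P cl k + solveTime P k + P.segE.cost + 30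

/-- Answers are 0 or 1, so `0 < acc + val` computes a disjunction. The pointer then skips the whole
block, which now contains stale marks and whatever the subroutine left, and the next attempt starts
on zero memory. -/
theorem body_tr (hc : c.Fits) (hregs : c.plan.sub.RegsBelow c.plan.regs)
    (hregs0 : 0 < c.plan.regs) (hcode : c.IsCode cl q code)
    (hsub : 2 ≤ c.n → c.SubSpec G T cl q code)
    (hval : ∀ i, ∀ p < (c.inst.pts i).length, |c.value cl q i p| < c.H) (hp₀ : c.Z ≤ p₀)
    (hbound : p₀ + (3 * k + 4) * c.Z ≤ c.N ^ c.E) (h : c.Ready p₀ s) (hidx : s.var .idx = q)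
    (hacc : s.var .acc = truth A) :
    Tr G c.N c.E (c.plan.body cl) s ((c.n + 1 + 2 * T) * bodyTime c.plan cl) fun s' =>
      c.Ready (p₀ + (3 * k + 4) * c.Z) s' ∧ s'.var .idx = q ∧
        s'.var .acc = truth (A ∨ c.Hit cl q) := by
  classical
  have hZ := c.one_le_Z
  have hE : (1 : ℤ) ≤ c.N ^ c.E := hZ.trans hc.Z_le
  have hst : c.Stage p₀ (truth A) q code 0 0 s := by
    have := h.stage (code := code)
    rwa [hacc, hidx] at this
  refine (Tr.seq ((fills_tr hc hval hp₀ hcode.card hcode.entry hst le_rfl).mono le_rfl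
    fun s1 _ h1 => Tr.seq ((solve_tr hc hregs hregs0 hcode hsub hp₀ h1).mono le_rfl
      fun s2 _ h2 => Tr.seq (Tr.assign c.two_le_N ?_ (Tr.assign c.two_le_N ?_ ?_))))).mono ?_
      fun _ _ h => h
  · simp only [Expr.eval_lt]
    split_ifs <;> simp <;> omega
  · obtain ⟨hi, hptr, -⟩ := h2
    have hi' : c.HasInput (s2.set .acc ((Expr.lt (.num 0) (.var .acc + .var .val)).eval s2)) :=
      ⟨by simpa using hi.size, by simpa using hi.bits, hi.inp⟩
    simp only [Expr.eval_add, Expr.eval_mul, hi'.eval_segE]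
    simp only [Expr.eval_var, Store.set_var, hptr, Expr.eval_num]
    have hp : 0 ≤ p₀ := by omega
    have hnn : 0 ≤ p₀ + (3 * k + 4) * c.Z := by positivity
    simpa [abs_of_nonneg hnn] using hbound
  · obtain ⟨hi, hptr, ha, hix, hv, hz⟩ := h2
    have hi' : c.HasInput (s2.set .acc ((Expr.lt (.num 0) (.var .acc + .var .val)).eval s2)) :=
      ⟨by simpa using hi.size, by simpa using hi.bits, hi.inp⟩
    refine ⟨⟨⟨by simpa using hi.size, by simpa using hi.bits, hi.inp⟩, ?_, fun a ha => hz a ?_⟩,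
      by simpa using hix, ?_⟩
    · rw [Store.set_var, if_pos rfl, Expr.eval_add, Expr.eval_mul, hi'.eval_segE]
      simp [hptr]
    · linarith
    · simp only [Store.set_var, Expr.eval_lt, Expr.eval_add, Expr.eval_num, Expr.eval_var, ha, hv]
      by_cases hA : A <;> by_cases hH : c.Hit cl q <;> simp [truth, hA, hH]
  · have hacc : (Expr.lt (.num 0) (.var .acc + .var .val)).cost = 7 := rfl
    have hptr : (Expr.var .ptr + .num (3 * k + 4 : ℕ) * c.plan.segE).cost =
        2 + (1 + (c.plan.segE.cost + 1) + 1) := rfl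
    rw [hacc, hptr, bodyTime]
    have h1 : 1 ≤ c.n + 1 + 2 * T := by omega
    nlinarith [Nat.zero_le (T * fillsTime c.plan cl k), Nat.zero_le (T * solveTime c.plan k),
      Nat.zero_le (T * c.plan.segE.cost), Nat.zero_le (c.n * c.plan.segE.cost),
      Nat.zero_le (c.n * solveTime c.plan k)]

end Run

end FOPZ

/-! ### Looping over attempts and clauses; size and bit length -/

namespace FOPZ

open WordRAM

namespace Run

variable {k : ℕ} {d : Fin k → ℕ} {l : ℕ} (c : Run k d l)

/-- All attempts for `cl` use bounded numbers and are decided by `c.plan.sub`. -/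
def Attempts (G : Prop) (T : ℕ) (cl : List (Aff (Var k d l))) : Prop :=
  ∀ q < c.D ^ c.plan.len,
    (∃ code, c.IsCode cl q code ∧ (2 ≤ c.n → c.SubSpec G T cl q code)) ∧
      ∀ i, ∀ p < (c.inst.pts i).length, |c.value cl q i p| < c.H

/-- The memory used for the attempts for one clause. -/
def span : ℤ := (c.D ^ c.plan.len : ℕ) * ((3 * k + 4) * c.Z)

variable {c} {p₀ : ℤ} {s : Store} {cl : List (Aff (Var k d l))} {T : ℕ} {G : Prop} {A : Prop}

theorem Ready.set_idx (h : c.Ready p₀ s) (v : ℤ) : c.Ready p₀ (s.set .idx v) :=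
  ⟨⟨by simpa using h.size, by simpa using h.bits, h.inp⟩, by simpa using h.ptr, h.zero⟩

def clauseTime (P : Plan) (cl : List (Aff (Var k d l))) : ℕ :=
  bodyTime P cl + ((P.waysE k).pow P.len).cost + 10

theorem clause_tr (hc : c.Fits) (hregs : c.plan.sub.RegsBelow c.plan.regs)
    (hregs0 : 0 < c.plan.regs) (hat : c.Attempts G T cl) (hp₀ : c.Z ≤ p₀)
    (hbound : p₀ + c.span ≤ c.N ^ c.E) (h : c.Ready p₀ s)
    (hacc : s.var .acc = truth A) :
    Tr G c.N c.E (c.plan.clause cl) s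
      ((c.D ^ c.plan.len + 1) * ((c.n + 1 + 2 * T) * clauseTime c.plan cl)) fun s' =>
      c.Ready (p₀ + c.span) s' ∧ s'.var .acc =
        truth (A ∨ ∃ q < c.D ^ c.plan.len, c.Hit cl q) := by
  classical
  have hZ := c.one_le_Z
  set u : ℤ := (3 * k + 4) * c.Z with hu
  have hu1 : 1 ≤ u := by nlinarith [(by positivity : (0 : ℤ) ≤ k * c.Z)]
  have hstep : ∀ j ≤ c.D ^ c.plan.len, p₀ + j * u ≤ c.N ^ c.E := by
    intro j hj
    refine le_trans ?_ hbound
    have : (j : ℤ) ≤ (c.D ^ c.plan.len : ℕ) := by exact_mod_cast hj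
    have := mul_le_mul_of_nonneg_right this (by omega : 0 ≤ u)
    rw [span]; linarith
  have hJ : ((c.D ^ c.plan.len : ℕ) : ℤ) ≤ c.N ^ c.E := by
    have h1 := hstep _ le_rfl
    nlinarith [(Nat.cast_nonneg (c.D ^ c.plan.len) : (0 : ℤ) ≤ _)]
  refine (Tr.range c.two_le_N (J := c.D ^ c.plan.len)
    (t := (c.n + 1 + 2 * T) * bodyTime c.plan cl) hJ
    (fun j s => s.var .idx = j ∧ c.Ready (p₀ + j * u) s ∧
      s.var .acc = truth (A ∨ ∃ q < j, c.Hit cl q))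
    ⟨by simp, by simpa using h.set_idx 0, by simpa using hacc⟩
    (fun j s h => ?_) (fun _ _ h => h.1) ?_ (fun s h => ?_)).mono ?_ fun _ _ h => h
  · simp [h.2.1.eval_waysE]
  · rintro j hj s ⟨hidx, hr, ha⟩
    obtain ⟨⟨code, hcode, hsub⟩, hval⟩ := hat j hj
    have hju : 0 ≤ j * u := by positivity
    refine (body_tr hc hregs hregs0 hcode hsub hval (by linarith) ?_ hr hidx ha).mono le_rfl
      fun s' _ h' => ?_
    · have := hstep (j + 1) hj
      push_cast at this
      linarith
    · obtain ⟨h1, h2, h3⟩ := h'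
      refine ⟨h2, by simp, ?_, ?_⟩
      · have : p₀ + (j + 1 : ℕ) * u = p₀ + j * u + u := by push_cast; ring
        rw [this]
        exact h1.set_idx _
      · rw [Store.set_var, if_neg (by simp), h3]
        congr 1
        rw [or_assoc]
        apply propext
        refine or_congr Iff.rfl ?_
        constructor
        · rintro (⟨q, hq, hh⟩ | hh)
          · exact ⟨q, by omega, hh⟩
          · exact ⟨j, by omega, hh⟩
        · rintro ⟨q, hq, hh⟩
          by_cases hqj : q = j
          · subst hqj; exact Or.inr hh
          · exact Or.inl ⟨q, by omega, hh⟩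
  · exact ⟨h.2.1, h.2.2⟩
  · rw [clauseTime]
    generalize ((c.plan.waysE k).pow c.plan.len).cost = w
    have h1 : w + 10 ≤ (c.n + 1 + 2 * T) * (w + 10) := Nat.le_mul_of_pos_left _ (by omega)
    have h2 : (c.n + 1 + 2 * T) * (bodyTime c.plan cl + w + 10) =
        (c.n + 1 + 2 * T) * bodyTime c.plan cl + (c.n + 1 + 2 * T) * (w + 10) := by ring
    rw [h2, add_mul (c.D ^ c.plan.len) 1, one_mul, add_assoc _ w 10, add_assoc _ w 10]
    exact Nat.add_le_add (Nat.mul_le_mul_left _ (by omega)) (by omega)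

def clausesTime (P : Plan) : List (List (Aff (Var k d l))) → ℕ
  | [] => 1
  | cl :: cls => clauseTime P cl + clausesTime P cls

theorem clauses_tr (hc : c.Fits) (hregs : c.plan.sub.RegsBelow c.plan.regs)
    (hregs0 : 0 < c.plan.regs) (cls : List (List (Aff (Var k d l))))
    (hat : ∀ cl ∈ cls, c.Attempts G T cl) (hp₀ : c.Z ≤ p₀)
    (hbound : p₀ + cls.length * c.span ≤ c.N ^ c.E) (h : c.Ready p₀ s)
    (hacc : s.var .acc = truth A) :
    Tr G c.N c.E (c.plan.clauses cls) s
      ((c.D ^ c.plan.len + 1) * ((c.n + 1 + 2 * T) * clausesTime c.plan cls)) fun s' =>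
        s'.var .acc =
          truth (A ∨ ∃ cl ∈ cls, ∃ q < c.D ^ c.plan.len, c.Hit cl q) := by
  classical
  induction cls generalizing p₀ s A with
  | nil =>
    refine (Tr.skip (by simpa using hacc)).mono ?_ fun _ _ h => h
    rw [clausesTime, mul_one]
    exact Nat.mul_pos (by omega) (by omega)
  | cons cl cls ih =>
    have hspan : 0 ≤ c.span := by have := c.one_le_Z; unfold span; positivity
    have hspan' : 0 ≤ cls.length * c.span := by positivity
    rw [List.length_cons] at hbound
    push_cast at hbound
    rw [Plan.clauses, clausesTime, Nat.mul_add, Nat.mul_add]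
    refine Tr.seq ((clause_tr hc hregs hregs0 (hat cl List.mem_cons_self) hp₀ (by linarith) h
      hacc).mono le_rfl fun s1 _ h1 => ?_)
    refine (ih (fun cl hcl => hat cl (List.mem_cons_of_mem _ hcl)) (p₀ := p₀ + c.span)
      (by linarith) (by linarith) h1.1 h1.2).mono le_rfl fun s2 _ h2 => ?_
    rw [h2]
    congr 1
    rw [or_assoc, List.exists_mem_cons_iff]

/-- The size and the bit length are `n` and `w`, and no successful attempt has been recorded. -/
structure Fresh (s : Store) (n w : ℤ) : Prop where
  size : s.var .size = n
  bits : s.var .bits = w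
  acc : s.var .acc = 0

def findSizeTime : ℕ → ℕ
  | 0 => 1
  | j + 1 => findSizeTime j + 16

theorem findSize_tr (hc : c.Fits) {mem : ℤ → ℤ} (hmem : mem = (initState c.inst.code).mem)
    (s : Store) (hs : Fresh s 0 0) (hsm : s.mem = mem) {j : ℕ} (hj : j ≤ k) :
    Tr G c.N c.E (Plan.findSize j) s (findSizeTime j) fun s' =>
      s'.mem = mem ∧ ∃ m : ℕ, Fresh s' m 0 ∧ m ≤ c.n ∧
        ∀ i : Fin k, i.val < j → (c.inst.pts i).length ≤ m := by
  induction j with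
  | zero =>
    exact Tr.skip ⟨hsm, 0, by simpa using hs, Nat.zero_le _, fun i hi => absurd hi (by omega)⟩
  | succ j ih =>
    rw [Plan.findSize, findSizeTime]
    refine Tr.seq ((ih (by omega)).mono le_rfl fun s1 _ h1 => ?_)
    obtain ⟨hm1, m, hf, hmn, hle⟩ := h1
    have hlen : s1.mem j = (c.inst.pts ⟨j, hj⟩).length := by
      rw [hm1, hmem, ← c.inst.getD_code_card]
      simp [initState]
    have hev : (Expr.var .size + .lt (.var .size) (.ld (.num j)) *
        (.ld (.num j) - .var .size)).eval s1 =
          (max m (c.inst.pts ⟨j, hj⟩).length : ℕ) := by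
      simp only [Expr.eval_add, Expr.eval_mul, Expr.eval_lt, Expr.eval_sub, Expr.eval_var,
        Expr.eval_ld, Expr.eval_num, hf.size, hlen]
      split_ifs with h
      · rw [max_eq_right (by omega)]; ring
      · rw [max_eq_left (by omega)]; ring
    have hmax : max m (c.inst.pts ⟨j, hj⟩).length ≤ c.n :=
      max_le hmn (c.inst.length_le_size _)
    have hn : (c.n : ℤ) ≤ c.N ^ c.E := by
      refine le_trans ?_ (hc.pad_le.trans hc.Z_le)
      have := c.one_le_H
      linarith [(by positivity : (0 : ℤ) ≤ k * c.H)]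
    refine (Tr.assign c.two_le_N ?_ ?_).mono (le_of_eq rfl) fun _ _ h => h
    · rw [hev, Nat.abs_cast]
      exact le_trans (by exact_mod_cast hmax) hn
    · rw [hev]
      refine ⟨hm1, _, ⟨by simp, by simpa using hf.bits, by simpa using hf.acc⟩, hmax,
        fun i hi => ?_⟩
      by_cases hij : i.val = j
      · subst hij; exact le_max_right _ _
      · exact (hle i (by omega)).trans (le_max_left _ _)

def findBitsTime : ℕ := (Expr.shr Plan.baseE (.var .bits)).cost +
  (Expr.var .bits + .num 1).cost + 10

/-- Shifting `n + 2` right by `j` bits gives zero exactly from `j = Nat.size (n + 2)` on, so the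
loop stops with `bits = W`. -/
theorem findBits_tr (hW : (c.W : ℤ) ≤ c.N ^ c.E) {mem : ℤ → ℤ} (s : Store)
    (hs : Fresh s c.n 0) (hsm : s.mem = mem) :
    Tr G c.N c.E Plan.findBits s ((c.W + 1) * findBitsTime) fun s' =>
      s'.mem = mem ∧ Fresh s' c.n c.W := by
  have hev : ∀ {j : ℕ} {s : Store}, Fresh s c.n j →
      (Expr.shr Plan.baseE (.var .bits)).eval s = (((c.n + 2) / 2 ^ j : ℕ) : ℤ) := by
    intro j s h
    simp [Plan.baseE, h.size, h.bits]
  refine (Tr.loop c.two_le_N (J := c.W) (t := (Expr.var .bits + .num 1).cost + 2)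
    (fun j s => s.mem = mem ∧ Fresh s c.n j) ⟨hsm, by simpa using hs⟩ ?_ ?_).mono ?_
    fun _ _ h => h
  · rintro j hj s ⟨hm, hf⟩
    refine ⟨?_, ?_⟩
    · rw [hev hf]
      have : 2 ^ j ≤ c.n + 2 := Nat.lt_size.1 hj
      have : 0 < (c.n + 2) / 2 ^ j := Nat.div_pos this (by positivity)
      omega
    · have hb : (Expr.var .bits + .num 1).eval s = ((j + 1 : ℕ) : ℤ) := by
        simp [hf.bits]
      refine Tr.assign c.two_le_N ?_ ?_
      · rw [hb, Nat.abs_cast]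
        exact le_trans (by exact_mod_cast hj) hW
      · rw [hb]
        exact ⟨hm, ⟨by simpa using hf.size, by simp, by simpa using hf.acc⟩⟩
  · rintro s ⟨hm, hf⟩
    refine ⟨?_, hm, hf⟩
    rw [hev hf, Nat.div_eq_of_lt]
    · rfl
    · exact Nat.size_le.1 le_rfl
  · rw [findBitsTime, Nat.succ_mul, add_assoc]
    refine Nat.add_le_add (Nat.mul_le_mul_left _ (by omega)) (by omega)

def mainTime (P : Plan) (cls : List (List (Aff (Var k d l)))) : ℕ :=
  findSizeTime k + 3 * findBitsTime + (P.segE.cost + 2) + clausesTime P cls + 20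

theorem main_tr (hc : c.Fits) (hregs : c.plan.sub.RegsBelow c.plan.regs)
    (hregs0 : 0 < c.plan.regs) (cls : List (List (Aff (Var k d l))))
    (hat : ∀ cl ∈ cls, c.Attempts G T cl)
    (hbound : c.Z + cls.length * c.span ≤ c.N ^ c.E) {x y : ℤ} (hxy : |x| + |y| ≤ 2)
    (hs : Fresh s 0 0) (hsm : s.mem = (initState c.inst.code).mem) :
    Tr G c.N c.E (c.plan.main cls x y) s
      ((c.D ^ c.plan.len + 1) * ((c.n + 1 + 2 * T) * mainTime c.plan cls)) fun s' =>
        s'.var .acc = x + y * truth (∃ cl ∈ cls, ∃ q < c.D ^ c.plan.len, c.Hit cl q) := by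
  have hZ := c.one_le_Z
  have hWn : c.W ≤ c.n + 2 := Nat.size_le.2 Nat.lt_two_pow_self
  have hNE : c.N ≤ c.N ^ c.E := by
    simpa using pow_le_pow_right₀ (by linarith [c.two_le_N] : 1 ≤ c.N) hc.one_le_E
  have hWE : (c.W : ℤ) ≤ c.N ^ c.E := by
    refine le_trans ?_ hNE
    rw [N]
    exact_mod_cast hWn
  refine (Tr.seq ((findSize_tr hc rfl s hs hsm le_rfl).mono le_rfl fun s1 _ h1 => ?_)
    (t' := (c.W + 1) * findBitsTime + (c.plan.segE.cost + 2 +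
      ((c.D ^ c.plan.len + 1) * ((c.n + 1 + 2 * T) * clausesTime c.plan cls) + 8)))).mono ?_
      fun _ _ h => h
  · obtain ⟨hm1, m, hf, hmn, hle⟩ := h1
    -- The computed maximum is at most `n` and bounds every cardinality, so it equals the supremum
    -- that defines `n`.
    obtain rfl : m = c.n :=
      le_antisymm hmn (Finset.sup_le fun i _ => hle i i.2 : c.inst.size ≤ m)
    refine Tr.seq ((findBits_tr hWE s1 hf hm1).mono le_rfl fun s2 _ h2 => ?_)
    obtain ⟨hm2, hf2⟩ := h2
    have hin : c.HasInput s2 := ⟨hf2.size, hf2.bits, fun a _ => by simp [hm2, initState]⟩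
    refine Tr.seq (Tr.assign c.two_le_N ?_ ?_)
    · rw [hin.eval_segE, abs_of_nonneg (by omega)]
      exact hc.Z_le
    · rw [hin.eval_segE]
      have hready : c.Ready c.Z (s2.set .ptr c.Z) := by
        refine ⟨⟨by simpa using hf2.size, by simpa using hf2.bits, hin.inp⟩, by simp,
          fun a ha => ?_⟩
        rw [Store.set_mem, hm2]
        simp only [initState]
        rw [if_pos (by omega), List.getD_eq_default]
        have := hc.code_le
        omega
      refine Tr.seq ((clauses_tr (A := False) hc hregs hregs0 cls hat le_rfl hbound hready
        (by simpa [truth] using hf2.acc)).mono le_rfl fun s3 _ h3 => ?_)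
      have hev : (Expr.num x + .num y * .var .acc).eval s3 =
          x + y * truth (∃ cl ∈ cls, ∃ q < c.D ^ c.plan.len, c.Hit cl q) := by
        simp [h3]
      refine Tr.assign c.two_le_N ?_ ?_
      · rw [hev]
        refine (abs_add_le _ _).trans (le_trans ?_ hNE)
        rw [abs_mul]
        have h1 := mul_le_mul_of_nonneg_left
          (abs_truth_le (∃ cl ∈ cls, ∃ q < c.D ^ c.plan.len, c.Hit cl q)) (abs_nonneg y)
        linarith [c.two_le_N]
      · rw [hev]; simp
  · rw [mainTime]
    set X := (c.D ^ c.plan.len + 1) * (c.n + 1 + 2 * T) with hX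
    have h1 : c.n + 1 ≤ X := by
      rw [hX]; nlinarith [Nat.zero_le (c.D ^ c.plan.len * (c.n + 1 + 2 * T))]
    -- Here `W + 1 ≤ n + 3 ≤ 3 * (n + 1)`, the origin of the factor 3 in `mainTime`.
    have h2 : (c.W + 1) * findBitsTime ≤ X * (3 * findBitsTime) := by
      calc (c.W + 1) * findBitsTime ≤ (3 * X) * findBitsTime :=
            Nat.mul_le_mul_right _ (by omega)
        _ = _ := by ring
    have h3 : ∀ y : ℕ, y ≤ X * y := fun y => Nat.le_mul_of_pos_left _ (by omega)
    rw [← mul_assoc, ← mul_assoc, ← hX]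
    have h4 := h3 (findSizeTime k)
    have h5 := h3 (c.plan.segE.cost + 2)
    have h6 := h3 20
    simp only [Nat.mul_add] at h5 h6 h2 ⊢
    omega

end Run

end FOPZ

/-! ### Choice of the exponents -/

namespace FOPZ

open WordRAM

/-- This turns constant factors into exponents, as needed for bounds of the form `(n + 2) ^ a`. -/
theorem natCast_le_pow {N : ℤ} (hN : 2 ≤ N) (a : ℕ) : (a : ℤ) ≤ N ^ a := by
  have h1 : (a : ℤ) < 2 ^ a := by exact_mod_cast Nat.lt_two_pow_self
  exact h1.le.trans (pow_le_pow_left₀ (by norm_num) hN a)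

theorem exists_forall_le {α : Type*} (L : List α) (f : α → ℕ) : ∃ b, ∀ a ∈ L, f a ≤ b := by
  induction L with
  | nil => exact ⟨0, by simp⟩
  | cons a L ih =>
    obtain ⟨b, hb⟩ := ih
    refine ⟨max (f a) b, fun a' ha' => ?_⟩
    rcases List.mem_cons.1 ha' with rfl | h
    · exact le_max_left _ _
    · exact (hb a' h).trans (le_max_right _ _)

namespace Run

variable {k : ℕ} {d : Fin k → ℕ} {l : ℕ} {c : Run k d l} {cl : List (Aff (Var k d l))}

/-- The constants of the program suit the clause `cl`. -/
structure Suits (c : Run k d l) (cl : List (Aff (Var k d l))) : Prop where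
  pos : 0 < k
  lev_pos : 0 < c.plan.lev
  rad_eq : c.plan.rad = c.plan.lev + 2 * k
  length_le : cl.length ≤ c.plan.len
  lin_le : ∀ L ∈ cl, ∀ i, ∀ x ∈ c.inst.pts i, |lin L c.inst.par i x| ≤ c.N ^ c.plan.lev

theorem N_pow_lt (c : Run k d l) (h : 0 < c.plan.lev) :
    c.N ^ c.plan.lev < 2 ^ (c.plan.lev * c.W) := by
  have h1 : c.N < 2 ^ c.W := by
    rw [N]
    exact_mod_cast Nat.size_le.1 (le_refl c.W)
  rw [mul_comm, pow_mul]
  exact pow_lt_pow_left₀ h1 (by linarith [c.two_le_N]) (by omega)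

theorem W_pos (c : Run k d l) : 0 < c.W := Nat.size_pos.2 (by omega)

/-- The surplus exponent `2 * k` in the radix supplies a factor `N ^ k * N ^ k ≥ (k + 1) ^ 2`, and
`k * (V + k) < V * (k + 1) ^ 2` for `V ≥ 1`. -/
theorem mul_add_lt_R (hs : c.Suits cl) : k * (c.N ^ c.plan.lev + k) < c.R := by
  have hN := c.two_le_N
  set V := c.N ^ c.plan.lev with hV
  have hV1 : 1 ≤ V := one_le_pow₀ (by linarith)
  have hk : (k : ℤ) + 1 ≤ c.N ^ k := by
    have h1 : ((k + 1 : ℕ) : ℤ) ≤ 2 ^ k := by exact_mod_cast Nat.lt_two_pow_self (n := k)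
    have := h1.trans (pow_le_pow_left₀ (by norm_num) hN k)
    exact_mod_cast this
  have hR : c.R = V * (c.N ^ k * c.N ^ k) := by
    rw [R, hs.rad_eq, hV]; ring
  rw [hR]
  have hk0 : (0 : ℤ) ≤ k := by positivity
  have h2 : ((k : ℤ) + 1) * (k + 1) ≤ c.N ^ k * c.N ^ k := by gcongr
  have h3 : V * (((k : ℤ) + 1) * (k + 1)) ≤ V * (c.N ^ k * c.N ^ k) := by gcongr
  nlinarith [mul_nonneg hk0 hk0]

theorem getD_mem {i : Fin k} {p : ℕ} (hp : p < (c.inst.pts i).length) :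
    (c.inst.pts i).getD p 0 ∈ c.inst.pts i := by
  rw [List.getD_eq_getElem _ _ hp]; exact List.getElem_mem hp

theorem abs_value_lt (hs : c.Suits cl) (q : ℕ) (i : Fin k) {p : ℕ}
    (hp : p < (c.inst.pts i).length) : |c.value cl q i p| < c.H := by
  have hA : c.N ^ c.plan.lev + k < c.R := by
    refine lt_of_le_of_lt ?_ (mul_add_lt_R hs)
    have h1 : (1 : ℤ) ≤ k := by exact_mod_cast hs.pos
    have h2 : 0 ≤ c.N ^ c.plan.lev + k := by have := c.two_le_N; positivity
    nlinarith
  refine (abs_comb_lt hs.pos hA (fun L hL => ?_) q).trans_le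
    (pow_le_pow_right₀ c.one_le_R hs.length_le)
  linarith [hs.lin_le L hL i _ (getD_mem hp)]

theorem entry_injective (hs : c.Suits cl) (q : ℕ) (i : Fin k) :
    Function.Injective (c.entry cl q i) := by
  refine padded_injective fun p hp => ?_
  have h1 : (1 : ℤ) ≤ k := by exact_mod_cast hs.pos
  have := (le_abs_self _).trans_lt (abs_value_lt hs q i hp)
  nlinarith [c.one_le_H]

theorem abs_entry_le (hs : c.Suits cl) (q : ℕ) (i : Fin k) {p : ℕ} (hp : p < c.n) :
    |c.entry cl q i p| ≤ k * c.H + c.n := by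
  have h1 : (1 : ℤ) ≤ k := by exact_mod_cast hs.pos
  have hH := c.one_le_H
  have hp' : (p : ℤ) ≤ c.n := by exact_mod_cast hp.le
  have hk : c.H ≤ k * c.H := by nlinarith
  unfold Run.entry padded
  split_ifs with h
  · have := abs_value_lt hs q i h.1
    linarith
  · rw [abs_of_nonneg (by positivity)]
    linarith

/-- The successful guess may depend on the tuple, but both are quantified existentially, so the
quantifiers commute and the pointwise equivalence applies. -/
theorem exists_hit_iff (hs : c.Suits cl) :
    (∃ q < c.D ^ c.plan.len, c.Hit cl q) ↔
      ∃ x : (i : Fin k) → Fin (d i) → ℤ, (∀ i, x i ∈ c.inst.pts i) ∧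
        ∀ L ∈ cl, 0 < L.value (assign x c.inst.par) := by
  have hhit : ∀ q, c.Hit cl q ↔ ∃ x : (i : Fin k) → Fin (d i) → ℤ, (∀ i, x i ∈ c.inst.pts i) ∧
      ∑ i, comb c.D c.R c.inst.par i (x i) cl q = 0 := by
    intro q
    refine (exists_sum_padded_eq_zero_iff (fun i => c.inst.length_le_size i)
      (fun i p hp => abs_value_lt hs q i hp) (by linarith [c.one_le_H])).trans ?_
    constructor
    · rintro ⟨f, hf, h⟩
      exact ⟨fun i => (c.inst.pts i).getD (f i) 0, fun i => getD_mem (hf i), h⟩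
    · rintro ⟨x, hx, h⟩
      choose f hf hfx using fun i => List.mem_iff_getElem.1 (hx i)
      refine ⟨f, hf, ?_⟩
      rw [← h]
      refine Finset.sum_congr rfl fun i _ => ?_
      rw [value, List.getD_eq_getElem _ _ (hf i), hfx i]
  have key : ∀ x : (i : Fin k) → Fin (d i) → ℤ, (∀ i, x i ∈ c.inst.pts i) →
      ((∃ q < c.D ^ c.plan.len, ∑ i, comb c.D c.R c.inst.par i (x i) cl q = 0) ↔
        ∀ L ∈ cl, 0 < L.value (assign x c.inst.par)) := by
    intro x hx
    refine exists_sum_comb_eq_zero_iff hs.pos (e := c.plan.lev * c.W)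
      (Nat.mul_pos hs.lev_pos c.W_pos) (by rw [D, mul_assoc]) (mul_add_lt_R hs)
      (fun i L hL => ?_) (fun i L hL => ?_) hs.length_le
    · exact (le_abs_self _).trans_lt ((hs.lin_le L hL i _ (hx i)).trans_lt (c.N_pow_lt hs.lev_pos))
    · linarith [hs.lin_le L hL i _ (hx i)]
  simp only [hhit]
  constructor
  · rintro ⟨q, hq, x, hx, h⟩
    exact ⟨x, hx, (key x hx).1 ⟨q, hq, h⟩⟩
  · rintro ⟨x, hx, h⟩
    obtain ⟨q, hq, h⟩ := (key x hx).2 h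
    exact ⟨q, hq, x, hx, h⟩

theorem suits_of_weight_le {X u : ℕ} (hI : c.inst.BoundedBy (c.inst.size ^ u)) (hk : 0 < k)
    (hlev : c.plan.lev = u + X + 1) (hrad : c.plan.rad = c.plan.lev + 2 * k)
    (hlen : cl.length ≤ c.plan.len) (hX : ∀ L ∈ cl, L.weight ≤ X) : c.Suits cl := by
  refine ⟨hk, by omega, hrad, hlen, fun L hL i x hx => ?_⟩
  have hN := c.two_le_N
  have hU : ((c.inst.size ^ u : ℕ) : ℤ) ≤ c.N ^ u := by
    push_cast
    refine pow_le_pow_left₀ (by positivity) ?_ u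
    simp [N, n]
  have h1 := abs_lin_le L (t := c.inst.par) (i := i) (x := x) (U := c.N ^ u)
    (one_le_pow₀ (by linarith)) (fun j => (hI.1 i x hx j).trans hU) (fun j => (hI.2 j).trans hU)
  have h2 : (L.weight : ℤ) ≤ c.N ^ X :=
    le_trans (by exact_mod_cast hX L hL) (natCast_le_pow hN X)
  calc |lin L c.inst.par i x| ≤ L.weight * c.N ^ u := h1
    _ ≤ c.N ^ X * c.N ^ u := by gcongr
    _ = c.N ^ (u + X) := by ring
    _ ≤ c.N ^ c.plan.lev := pow_le_pow_right₀ (by linarith) (by omega)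

/-- An exponent for the numbers in the instances of `k`-SUM. -/
def padExp (P : Plan) (k : ℕ) : ℕ := P.rad * P.len + k + 1

/-- The factor `k` is absorbed by `N ^ k`, and one more factor `N` makes room for the positions
added to the fillers. -/
theorem pad_le (c : Run k d l) : k * c.H + c.n ≤ c.N ^ padExp c.plan k := by
  have hN := c.two_le_N
  have hk := natCast_le_pow hN k
  have hk1 : (1 : ℤ) ≤ c.N ^ k := one_le_pow₀ (by linarith)
  have hH := c.one_le_H
  have hn : (c.n : ℤ) ≤ c.N := by simp [N]
  have h1 : c.N ^ padExp c.plan k = c.H * c.N ^ k * c.N := by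
    rw [padExp, H, R]; ring
  rw [h1]
  have h2 : k * c.H ≤ c.H * c.N ^ k := by
    rw [mul_comm]; gcongr
  have h3 : 1 ≤ c.H * c.N ^ k := by nlinarith
  have h4 : (c.n : ℤ) = c.N - 2 := by simp [N]
  nlinarith

theorem length_code_le (c : Run k d l) :
    c.inst.code.length ≤ (k + l + ∑ i, d i) * (c.n + 2) := by
  rw [Instance.length_code]
  have h : ∑ i, (c.inst.pts i).length * d i ≤ ∑ i, (c.n + 2) * d i :=
    Finset.sum_le_sum fun i _ =>
      Nat.mul_le_mul_right _ ((c.inst.length_le_size i).trans (Nat.le_add_right _ _))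
  rw [← Finset.mul_sum] at h
  nlinarith

/-- An exponent for the unit of memory allocation. -/
def segExp (k l ds a₀ e : ℕ) : ℕ := a₀ + e + (k + l + ds) + 1

theorem fits_of_seg (hk : 0 < k)
    (hseg : c.plan.seg = segExp k l (∑ i, d i) c.plan.exp (padExp c.plan k))
    (hE : c.plan.seg ≤ c.E) : c.Fits := by
  have hN := c.two_le_N
  have hmono : ∀ {a b : ℕ}, a ≤ b → c.N ^ a ≤ c.N ^ b := fun h =>
    pow_le_pow_right₀ (by linarith) h
  have hN' : c.N = ((c.n + 2 : ℕ) : ℤ) := by rw [N]; push_cast; rfl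
  rw [segExp] at hseg
  refine ⟨hk, ?_, ?_, c.pad_le.trans (hmono (by omega)), by omega, hE, by omega⟩
  · calc (c.inst.code.length : ℤ) ≤ ((k + l + ∑ i, d i : ℕ) : ℤ) * c.N := by
          rw [hN']; exact_mod_cast c.length_code_le
      _ ≤ c.N ^ (k + l + ∑ i, d i) * c.N := by gcongr; exact natCast_le_pow hN _
      _ = c.N ^ ((k + l + ∑ i, d i) + 1) := by ring
      _ ≤ c.Z := hmono (by omega)
  · calc (k : ℤ) + k * c.n ≤ k * c.N := by rw [N]; nlinarith [(by positivity : (0 : ℤ) ≤ k)]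
      _ ≤ c.N ^ k * c.N := by gcongr; exact natCast_le_pow hN _
      _ = c.N ^ (k + 1) := by ring
      _ ≤ c.Z := hmono (by omega)

/-- An exponent for all words. -/
def wordExp (P : Plan) (k L : ℕ) : ℕ :=
  (1 + L) + (k * P.lev + 1) * P.len + (3 * k + 4) + P.seg

/-- Memory is never reused, but with the crude bound `W ≤ N` the number of attempts is polynomial,
so all addresses still fit into words. -/
theorem total_le (hk : 0 < k) (hlev : 0 < c.plan.lev) {L : ℕ} (hE : wordExp c.plan k L ≤ c.E) :
    c.Z + L * c.span ≤ c.N ^ c.E := by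
  have hN := c.two_le_N
  have hZ := c.one_le_Z
  have hW : (c.W : ℤ) ≤ c.N := by
    rw [N]; exact_mod_cast Nat.size_le.2 Nat.lt_two_pow_self
  have hD0 : 0 < c.D := Nat.mul_pos (Nat.mul_pos hk hlev) c.W_pos
  have hDM : (1 : ℤ) ≤ (c.D ^ c.plan.len : ℕ) := by exact_mod_cast Nat.pow_pos hD0
  have hD : ((c.D ^ c.plan.len : ℕ) : ℤ) ≤ c.N ^ ((k * c.plan.lev + 1) * c.plan.len) := by
    rw [pow_mul]
    push_cast
    refine pow_le_pow_left₀ (by positivity) ?_ _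
    rw [D, pow_succ]
    push_cast
    have := natCast_le_pow hN (k * c.plan.lev)
    push_cast at this
    gcongr
  have h34 : (3 * k + 4 : ℤ) ≤ c.N ^ (3 * k + 4) := by
    exact_mod_cast natCast_le_pow hN (3 * k + 4)
  have hL : (1 + L : ℤ) ≤ c.N ^ (1 + L) := by exact_mod_cast natCast_le_pow hN (1 + L)
  have hspan : c.Z ≤ c.span := by
    rw [span]
    have h1 : c.Z ≤ (3 * k + 4) * c.Z := by nlinarith [(by positivity : (0 : ℤ) ≤ k * c.Z)]
    nlinarith
  calc c.Z + L * c.span ≤ (1 + L) * c.span := by linarith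
    _ = (1 + L) * ((c.D ^ c.plan.len : ℕ) * ((3 * k + 4) * c.Z)) := rfl
    _ ≤ c.N ^ (1 + L) * (c.N ^ ((k * c.plan.lev + 1) * c.plan.len) *
        (c.N ^ (3 * k + 4) * c.Z)) := by gcongr
    _ = c.N ^ wordExp c.plan k L := by rw [wordExp, Z]; ring
    _ ≤ c.N ^ c.E := pow_le_pow_right₀ (by linarith) hE

end Run

end FOPZ

/-! ### Assembling the program and the time bound -/

namespace FOPZ

open WordRAM

variable {k : ℕ} {d : Fin k → ℕ} {l : ℕ}

namespace Run

variable {c : Run k d l} {cl : List (Aff (Var k d l))}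

theorem isCode_sumInstance (hs : c.Suits cl) (q : ℕ) :
    c.IsCode cl q (sumInstance k c.n (c.entry cl q) (entry_injective hs q)).code :=
  ⟨sumInstance_length_code _, fun _ hb => sumInstance_getD_code_card _ hb,
    fun i _ hp => sumInstance_getD_code _ i hp⟩

/-- The universe is measured by powers of `n` rather than of `n + 2`. For `n ≥ 2` one has `n + 2 ≤ n
^ 2`, so doubling the exponent suffices. -/
theorem sumInstance_entry_boundedBy (hs : c.Suits cl) (q : ℕ) (hn : 2 ≤ c.n) :
    (sumInstance k c.n (c.entry cl q) (entry_injective hs q)).BoundedBy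
      (c.n ^ (2 * padExp c.plan k)) := by
  refine sumInstance_boundedBy _ fun i p hp => ?_
  refine (abs_entry_le hs q i hp).trans (c.pad_le.trans ?_)
  push_cast
  rw [pow_mul]
  refine pow_le_pow_left₀ (by linarith [c.two_le_N]) ?_ _
  have : (2 : ℤ) ≤ c.n := by exact_mod_cast hn
  rw [N]
  nlinarith

theorem attempts_of_solves {T : ℕ → ℝ} {N₀ : ℕ} {C : ℝ}
    (hsub : ∀ I : Instance k (fun _ => 1) 0, (kSum k).valid I →
      I.BoundedBy (I.size ^ (2 * padExp c.plan k)) → ∃ t s,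
        Exec (((I.size + 2) ^ c.plan.exp : ℕ) : ℤ) c.plan.sub (initState I.code) t s ∧
        ((kSum k).yes I → s.reg 0 = 1) ∧ (¬ (kSum k).yes I → s.reg 0 = 0) ∧
        (N₀ ≤ I.size → ((I.code.length + t : ℕ) : ℝ) ≤ C * T I.size))
    (hs : c.Suits cl) : c.Attempts (N₀ ≤ c.n) ⌊C * T c.n⌋₊ cl := by
  refine fun q _ => ⟨⟨_, isCode_sumInstance hs q, fun hn => ?_⟩,
    fun i p hp => abs_value_lt hs q i hp⟩
  have hsize := sumInstance_size (entry_injective hs q) hs.pos (n := c.n)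
  obtain ⟨t, s, he, hyes, hno, ht⟩ := hsub
    (sumInstance k c.n (c.entry cl q) (entry_injective hs q)) (sumInstance_valid _ hs.pos)
    (by rw [hsize]; exact sumInstance_entry_boundedBy hs q hn)
  rw [hsize] at he ht
  refine ⟨t, s, by rw [N]; exact_mod_cast he, fun g => Nat.le_floor ?_, ?_⟩
  · refine le_trans ?_ (ht g)
    exact_mod_cast Nat.le_add_left _ _
  · rw [sumInstance_yes] at hyes hno
    by_cases h : c.Hit cl q
    · rw [hyes h, truth, if_pos h]
    · rw [hno h, truth, if_neg h]

end Run

/-- Since the input has to be loaded, `k`-SUM needs linear time. -/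
theorem natCast_le_of_solves (hk : 0 < k) {T : ℕ → ℝ} {p : Cmd} {a u N₀ n : ℕ} {C : ℝ}
    (hu : 0 < u) (hn : N₀ ≤ n)
    (hsub : ∀ I : Instance k (fun _ => 1) 0, (kSum k).valid I →
      I.BoundedBy (I.size ^ u) → ∃ t s,
        Exec (((I.size + 2) ^ a : ℕ) : ℤ) p (initState I.code) t s ∧
        ((kSum k).yes I → s.reg 0 = 1) ∧ (¬ (kSum k).yes I → s.reg 0 = 0) ∧
        (N₀ ≤ I.size → ((I.code.length + t : ℕ) : ℝ) ≤ C * T I.size)) :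
    (n : ℝ) ≤ C * T n := by
  have hinj : ∀ _ : Fin k, Function.Injective (fun p : ℕ => (p : ℤ)) := fun _ => Nat.cast_injective
  have hsize := sumInstance_size hinj hk (n := n)
  obtain ⟨t, s, -, -, -, ht⟩ := hsub (sumInstance k n _ hinj) (sumInstance_valid _ hk) (by
    rw [hsize]
    refine sumInstance_boundedBy _ fun _ p hp => ?_
    rw [Nat.abs_cast]
    exact_mod_cast hp.le.trans (Nat.le_self_pow hu.ne' n))
  rw [hsize] at ht
  refine le_trans ?_ (ht hn)
  rw [sumInstance_length_code]
  have : n ≤ k * n := Nat.le_mul_of_pos_left n hk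
  exact_mod_cast (by omega : n ≤ k + k * n + t)

/-- With `w + 1` bits, `2 ^ w ≤ n + 2 ≤ n ^ 2`, and `log 2 ≥ 1 / 2` gives `w ≤ 4 * log n`; the last
bit is paid for by `log n ≥ 1`. -/
theorem size_le_mul_log {n : ℕ} (hn : 3 ≤ n) : (Nat.size (n + 2) : ℝ) ≤ 5 * Real.log n := by
  have hlog : 1 ≤ Real.log n := by
    rw [Real.le_log_iff_exp_le (by positivity)]
    have : (3 : ℝ) ≤ n := by exact_mod_cast hn
    linarith [Real.exp_one_lt_d9]
  obtain ⟨w, hw⟩ : ∃ w, Nat.size (n + 2) = w + 1 :=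
    ⟨Nat.size (n + 2) - 1, by have : 0 < Nat.size (n + 2) := Nat.size_pos.2 (by omega)
                              omega⟩
  have h1 : 2 ^ w ≤ n ^ 2 := by
    have : 2 ^ w ≤ n + 2 := Nat.lt_size.1 (by omega)
    nlinarith
  have h2 : (w : ℝ) * Real.log 2 ≤ 2 * Real.log n := by
    have h3 : Real.log ((2 : ℝ) ^ w) ≤ Real.log ((n : ℝ) ^ 2) :=
      Real.log_le_log (by positivity) (by exact_mod_cast h1)
    rwa [Real.log_pow, Real.log_pow, Nat.cast_ofNat] at h3
  have h4 : (1 : ℝ) / 2 ≤ Real.log 2 := by linarith [Real.log_two_gt_d9]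
  have h5 : (w : ℝ) * (1 / 2) ≤ w * Real.log 2 := by gcongr
  rw [hw]
  push_cast
  linarith

/-- The program and its constants depend on `u`, but the exponent of the logarithm is the bound `M`
on the clause lengths, so it can be chosen before `u`. -/
theorem exists_program (hk : 0 < k) {T : ℕ → ℝ} (hT : (kSum k).SolvableInTime T)
    (cls : List (List (Aff (Var k d l)))) {x y : ℤ} (hxy : |x| + |y| ≤ 2) :
    ∃ e : ℕ, ∀ u : ℕ, ∃ (p : Cmd) (a N : ℕ) (C : ℝ), 0 < C ∧
      ∀ I : Instance k d l, I.BoundedBy (I.size ^ u) → ∃ (t : ℕ) (s : State),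
        Exec (((I.size + 2) ^ a : ℕ) : ℤ) p (initState I.code) t s ∧
        s.reg 0 = x + y * truth (∃ x : (i : Fin k) → Fin (d i) → ℤ, (∀ i, x i ∈ I.pts i) ∧
          SomeClause cls (assign x I.par)) ∧
        (N ≤ I.size →
          ((I.code.length + t : ℕ) : ℝ) ≤ C * (T I.size * Real.log I.size ^ e)) := by
  obtain ⟨M, hM⟩ := exists_forall_le cls List.length
  obtain ⟨X, hX⟩ := exists_forall_le cls.flatten Aff.weight
  refine ⟨M, fun u => ?_⟩
  -- This exponent is twice `padExp` of the plan below. It involves only the levels, the radix and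
  -- the clause length, so there is no circularity in fixing it before the subroutine.
  obtain ⟨p, a₀, N₀, C, hC, hp⟩ := hT (2 * ((u + X + 1 + 2 * k) * M + k + 1))
  obtain ⟨m, hm⟩ := p.exists_regsBelow
  -- A summand of a condition is at most `weight * N ^ u ≤ N ^ (X + u)`, which determines the first
  -- entry. One more register than needed ensures that register 0 is among those transferred.
  set P : Plan := ⟨u + X + 1, u + X + 1 + 2 * k, M,
    Run.segExp k l (∑ i, d i) a₀ ((u + X + 1 + 2 * k) * M + k + 1), p, m + 1, a₀⟩ with hP
  set E := Run.wordExp P k cls.length + u with hE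
  set K := Run.mainTime P cls with hK
  refine ⟨(P.main cls x y).cmd, (P.main cls x y).need E, max N₀ 3,
    -- The 8 is `2 * 4`, from `D ^ M + 1 ≤ 2 * (5 * k * lev * log n) ^ M` and `n + 1 + 2 * ⌊C * T n⌋
    -- ≤ 4 * C * T n`. The second summand pays for loading the input, and the 1 makes the constant
    -- positive.
    8 * C * (5 * k * P.lev) ^ M * K + 2 * (k + l + ∑ i, d i : ℕ) * C + 1, by positivity,
    fun I hI => ?_⟩
  set c : Run k d l := ⟨P, I, E⟩ with hc
  have hfits : c.Fits :=
    Run.fits_of_seg hk rfl (by simp only [hc, hE, Run.wordExp]; omega)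
  have hsuits : ∀ cl ∈ cls, c.Suits cl := fun cl hcl =>
    Run.suits_of_weight_le (u := u) (X := X) hI hk rfl rfl (hM cl hcl)
      fun L hL => hX L (List.mem_flatten.2 ⟨cl, hcl, hL⟩)
  have hN := c.two_le_N
  have hbdd : Store.Bounded c.N c.E ⟨fun _ => 0, (initState I.code).mem⟩ := by
    refine ⟨fun _ => by rw [abs_zero]; positivity, fun a => ?_⟩
    refine (I.abs_initState_mem_le hI a).trans (max_le ?_ ?_)
    · have h1 : c.N ≤ c.N ^ c.E := by
        simpa using pow_le_pow_right₀ (by linarith : 1 ≤ c.N) hfits.one_le_E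
      refine le_trans ?_ h1
      simp [Run.N, Run.n, hc]
    · push_cast
      calc (I.size : ℤ) ^ u ≤ c.N ^ u := pow_le_pow_left₀ (by positivity) (by simp [Run.N, Run.n, hc]) u
        _ ≤ c.N ^ c.E := pow_le_pow_right₀ (by linarith) (by simp only [hc, hE]; omega)
  obtain ⟨t, σ, s, hexec, ht, hrepr, -, hacc⟩ :=
    Run.main_tr (c := c) (G := N₀ ≤ c.n) (T := ⌊C * T c.n⌋₊) hfits
      (hm.mono (Nat.le_succ m)) (Nat.succ_pos m) cls
      (fun cl hcl => Run.attempts_of_solves hp (hsuits cl hcl))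
      (Run.total_le hk (Nat.succ_pos _) (by simp only [hc, hE]; omega)) hxy
      (s := ⟨fun _ => 0, (initState I.code).mem⟩) ⟨rfl, rfl, rfl⟩ rfl hbdd _ le_rfl
      (initState I.code) ⟨fun _ => rfl, rfl⟩
  refine ⟨t, σ, ?_, ?_, fun hn => ?_⟩
  · have : c.N = ((I.size + 2 : ℕ) : ℤ) := by simp [Run.N, Run.n, hc]
    rw [this] at hexec
    exact_mod_cast hexec
  · rw [show σ.reg 0 = s.var .acc from hrepr.var .acc, hacc]
    congr 3
    apply propext
    constructor
    · rintro ⟨cl, hcl, hq⟩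
      obtain ⟨x, hx, h⟩ := (Run.exists_hit_iff (hsuits cl hcl)).1 hq
      exact ⟨x, hx, cl, hcl, h⟩
    · rintro ⟨x, hx, cl, hcl, h⟩
      exact ⟨cl, hcl, (Run.exists_hit_iff (hsuits cl hcl)).2 ⟨x, hx, h⟩⟩
  · have hn3 : 3 ≤ I.size := (le_max_right _ _).trans hn
    have hlin : (I.size : ℝ) ≤ C * T I.size :=
      natCast_le_of_solves hk (by omega) ((le_max_left _ _).trans hn) hp
    have ht' := ht ((le_max_left _ _).trans hn)
    have hlog : 1 ≤ Real.log I.size := by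
      rw [Real.le_log_iff_exp_le (by positivity)]
      have : (3 : ℝ) ≤ I.size := by exact_mod_cast hn3
      linarith [Real.exp_one_lt_d9]
    have hn3' : (3 : ℝ) ≤ I.size := by exact_mod_cast hn3
    set Λ := Real.log I.size with hΛ
    have hΛM : 1 ≤ Λ ^ M := one_le_pow₀ hlog
    set B : ℝ := C * T I.size with hB
    have hfl : ((⌊B⌋₊ : ℕ) : ℝ) ≤ B := Nat.floor_le (by linarith)
    have hD1 : (1 : ℝ) ≤ ((c.D ^ M : ℕ) : ℝ) := by
      have : 0 < c.D := Nat.mul_pos (Nat.mul_pos hk (Nat.succ_pos _)) c.W_pos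
      exact_mod_cast Nat.pow_pos this
    have hDM : ((c.D ^ M : ℕ) : ℝ) ≤ (5 * k * P.lev) ^ M * Λ ^ M := by
      rw [← mul_pow]
      push_cast
      refine pow_le_pow_left₀ (by positivity) ?_ M
      have hW : (c.W : ℝ) ≤ 5 * Λ := size_le_mul_log hn3
      rw [Run.D]
      push_cast
      calc (k : ℝ) * c.plan.lev * c.W ≤ k * c.plan.lev * (5 * Λ) := by gcongr
        _ = 5 * k * P.lev * Λ := by ring
    have htime : (t : ℝ) ≤ 2 * ((5 * k * P.lev) ^ M * Λ ^ M) * (4 * B * K) := by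
      calc (t : ℝ) ≤ (((c.D ^ M + 1) * ((c.n + 1 + 2 * ⌊B⌋₊) * K) : ℕ) : ℝ) := by
            exact_mod_cast ht'
        _ = (((c.D ^ M : ℕ) : ℝ) + 1) * ((((I.size : ℕ) : ℝ) + 1 + 2 * (⌊B⌋₊ : ℕ)) * K) := by
            push_cast; rfl
        _ ≤ (2 * ((5 * k * P.lev) ^ M * Λ ^ M)) * (4 * B * K) := by
            gcongr
            · linarith
            · linarith
    have hlen : (I.code.length : ℝ) ≤ 2 * (k + l + ∑ i, d i : ℕ) * B := by
      calc (I.code.length : ℝ) ≤ (((k + l + ∑ i, d i) * (c.n + 2) : ℕ) : ℝ) := by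
            exact_mod_cast c.length_code_le
        _ = ((k + l + ∑ i, d i : ℕ) : ℝ) * ((I.size : ℕ) + 2) := by push_cast; rfl
        _ ≤ ((k + l + ∑ i, d i : ℕ) : ℝ) * (2 * B) := by gcongr; linarith
        _ = _ := by ring
    have hB0 : 0 ≤ B := by linarith
    have hlen' : 2 * ((k + l + ∑ i, d i : ℕ) : ℝ) * B ≤
        2 * (k + l + ∑ i, d i : ℕ) * B * Λ ^ M := le_mul_of_one_le_right (by positivity) hΛM
    have hT0 : 0 ≤ T I.size := by
      by_contra h
      have : B < 0 := mul_neg_of_pos_of_neg hC (not_le.1 h)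
      linarith
    have hTΛ : 0 ≤ T I.size * Λ ^ M := by positivity
    push_cast
    push_cast at hlen' hlen
    have hfin : (8 * C * (5 * k * P.lev) ^ M * K + 2 * (k + l + ∑ i, (d i : ℝ)) * C + 1) *
        (T I.size * Λ ^ M) = 2 * ((5 * k * P.lev) ^ M * Λ ^ M) * (4 * B * K) +
          2 * (k + l + ∑ i, (d i : ℝ)) * B * Λ ^ M + T I.size * Λ ^ M := by
      rw [hB]; ring
    rw [hfin]
    linarith

/-- The equation `x₁ + ⋯ + x_k = 0`. -/
def sumFormula (k : ℕ) : LinFormula (Var k (fun _ => 1) 0) := .eq (fun _ => 1) 0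

theorem kSum_yes_iff (I : Instance k (fun _ => 1) 0) :
    (kSum k).yes I ↔ (existsProblem (sumFormula k)).yes I := by
  simp [kSum, existsProblem, sumFormula, LinFormula.Holds, assign, Fintype.sum_sum_type,
    Fintype.sum_sigma]

theorem existsProblem_solvableInTime (hk : 0 < k) {T : ℕ → ℝ} (hT : (kSum k).SolvableInTime T)
    (ψ : LinFormula (Var k d l)) :
    ∃ c : ℕ, (existsProblem ψ).SolvableInTime fun n => T n * Real.log n ^ c := by
  obtain ⟨c, h⟩ := exists_program hk hT (ψ.dnf true) (x := 0) (y := 1) (by norm_num)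
  refine ⟨c, fun u => ?_⟩
  obtain ⟨p, a, N, C, hC, h⟩ := h u
  refine ⟨p, a, N, C, hC, fun I _ hI => ?_⟩
  obtain ⟨t, s, he, hr, ht⟩ := h I hI
  simp only [(ψ.someClause_dnf _).1] at hr
  refine ⟨t, s, he, fun hy => ?_, fun hy => ?_, ht⟩
  · rw [hr, truth, if_pos (by exact hy)]; norm_num
  · rw [hr, truth, if_neg (by exact hy)]; norm_num

/-- The program searches for a counterexample, using the clauses of the negated formula, and flips
the answer. -/
theorem forallProblem_solvableInTime (hk : 0 < k) {T : ℕ → ℝ} (hT : (kSum k).SolvableInTime T)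
    (ψ : LinFormula (Var k d l)) :
    ∃ c : ℕ, (forallProblem ψ).SolvableInTime fun n => T n * Real.log n ^ c := by
  obtain ⟨c, h⟩ := exists_program hk hT (ψ.dnf false) (x := 1) (y := -1) (by norm_num)
  refine ⟨c, fun u => ?_⟩
  obtain ⟨p, a, N, C, hC, h⟩ := h u
  refine ⟨p, a, N, C, hC, fun I _ hI => ?_⟩
  obtain ⟨t, s, he, hr, ht⟩ := h I hI
  simp only [(ψ.someClause_dnf _).2] at hr
  refine ⟨t, s, he, fun hy => ?_, fun hy => ?_, ht⟩
  · rw [hr, truth, if_neg]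
    · norm_num
    · rintro ⟨x, hx, hn⟩; exact hn (hy x hx)
  · rw [hr, truth, if_pos]
    · norm_num
    · by_contra hno
      exact hy fun x hx => not_not.1 fun hn => hno ⟨x, hx, hn⟩

end FOPZ

theorem mainTheorem1 (k : ℕ) (hk : 3 ≤ k) :
    (∃ ψ : FOPZ.LinFormula (FOPZ.Var k (fun _ => 1) 0), ∀ I : FOPZ.Instance k (fun _ => 1) 0,
      (FOPZ.kSum k).yes I ↔ (FOPZ.existsProblem ψ).yes I) ∧
    ∀ T : ℕ → ℝ, (FOPZ.kSum k).SolvableInTime T →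
      ∀ (d : Fin k → ℕ) (l : ℕ) (ψ : FOPZ.LinFormula (FOPZ.Var k d l)),
        (∃ c : ℕ, (FOPZ.existsProblem ψ).SolvableInTime fun n => T n * Real.log n ^ c) ∧
        (∃ c : ℕ, (FOPZ.forallProblem ψ).SolvableInTime fun n => T n * Real.log n ^ c) := by
  have hk0 : 0 < k := by omega
  exact ⟨⟨FOPZ.sumFormula k, FOPZ.kSum_yes_iff⟩, fun T hT d l ψ =>
    ⟨FOPZ.existsProblem_solvableInTime hk0 hT ψ, FOPZ.forallProblem_solvableInTime hk0 hT ψ⟩⟩
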